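/- Let $z_j=u_j+iv_j$ $(j=1,2)$ be the coordinates of $\mathbb C^2$, and for $b,c\in\mathbb R$ let $L^0_{bc}\subset\mathbb C^2$ be the plane $u_1+iu_2=(b+ic)(v_2+iv_1)$. Let $K_{\mathbb{CP}^1}$ be the total space of the canonical bundle $\mathcal O(-2)$ of $\mathbb{CP}^1$; for $0\ne z\in\mathbb C^2$ and $t\in\mathbb C$ write $[z,t]$ for its point $t\,z\otimes z$ over the line $\mathbb Cz$. Let $\pi:K_{\mathbb{CP}^1}\to\mathbb C^2/\mathbb Z_2$, $[z,t]\mapsto\pm\sqrt t\,z$, be the blow-down map; it contracts the zero section $E\cong\mathbb{CP}^1$ and is invertible elsewhere, with inverse induced by $z\mapsto[z,1]$. Let $a>0$. (i) With $U=|z_1|^2+|z_2|^2$, the form $$\omega=\frac{\sqrt{-1}}{U^2\sqrt{U^2+a^2}}\bigl[(U^2+a^2)\,U\,\partial\bar\partial U-a^2\,\partial U\wedge\bar\partial U\bigr]$$ and the form $dz_1\wedge dz_2$ on $\mathbb C^2\setminus\{0\}$ are the pull-backs of a smooth form $\omega$ and a nowhere vanishing holomorphic $(2,0)$-form $\Omega$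 on $K_{\mathbb{CP}^1}$. The form $\omega$ is the Kähler form of a Ricci-flat Kähler metric (the Eguchi–Hanson metric), and $\omega\wedge\omega=2\,\Omega\wedge\bar\Omega$. (ii) For all $b,c\in\mathbb R$ let $L_{bc}=\{[z,t]: 0\ne z\in L^0_{bc},\ t\in\mathbb R\}$. Then $L_{bc}$ is a closed, smoothly embedded surface in $K_{\mathbb{CP}^1}$; there is a diffeomorphism $f:S^1\times\mathbb R\to L_{bc}$ which maps $S^1\times(0,\infty)$ onto $\pi^{-1}$ of the image of $L^0_{bc}\setminus\{0\}$ in $\mathbb C^2/\mathbb Z_2$, maps the circle $S^1\times\{0\}$ onto $L_{bc}\cap E$, and maps $S^1\times(-\infty,0)$ onto $\pi^{-1}$ of the image of $i\,(L^0_{bc}\setminus\{0\})$. Thus $L_{bc}$ extends the lift of $L^0_{bc}$ across $E$. (iii) Each $L_{bc}$ is special Lagrangian: $\omega|_{L_{bc}}=0$ and $\operatorname{Im}\Omega|_{L_{bc}}=0$. (iv) The surfaces $L_{bc}$, $b,c\in\mathbb R$, cover $K_{\mathbb{CP}^1}$. -/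

import Mathlib

open scoped Manifold ContDiff

noncomputable section

namespace EguchiHanson

/-! ### The complex surface `K_{ℂP¹}` and the blow-down map -/

/-- Pairs `(z, t)` with `z ∈ ℂ² \ {0}` and `t ∈ ℂ`. -/
abbrev Pre : Type := {z : ℂ × ℂ // z ≠ 0} × ℂ

/-- `(z, t) ∼ (l z, l⁻² t)` for `l ∈ ℂ*`. The class of `(z, t)` is the element `t • (z ⊗ z)` of the
fibre of `𝒪(-2) = 𝒪(-1)^{⊗2}` over the line `ℂ z`. -/
def preSetoid : Setoid Pre where
  r x y := ∃ l : ℂ, l ≠ 0 ∧ y.1.1 = l • x.1.1 ∧ x.2 = l ^ 2 * y.2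
  iseqv :=
    { refl := fun x => ⟨1, one_ne_zero, by simp, by simp⟩
      symm := by
        rintro x y ⟨l, hl, h1, h2⟩
        refine ⟨l⁻¹, inv_ne_zero hl, ?_, ?_⟩
        · rw [h1, smul_smul, inv_mul_cancel₀ hl, one_smul]
        · rw [h2]; field_simp
      trans := by
        rintro x y z ⟨l, hl, h1, h2⟩ ⟨m, hm, h3, h4⟩
        refine ⟨m * l, mul_ne_zero hm hl, ?_, ?_⟩
        · rw [h3, h1, smul_smul]
        · rw [h2, h4]; ring }

/-- `K_{ℂP¹}`, the total space of the canonical line bundle `𝒪(-2)` of `ℂP¹`, as the quotient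
`((ℂ² \ {0}) × ℂ) / ℂ*`. -/
def KCP1 : Type := Quotient preSetoid

/-- The point `[z, t] = t • (z ⊗ z)` of `K_{ℂP¹}`. -/
def mk (x : Pre) : KCP1 := Quotient.mk preSetoid x

instance : TopologicalSpace KCP1 := inferInstanceAs (TopologicalSpace (Quotient preSetoid))

theorem isQuotientMap_mk : Topology.IsQuotientMap mk := isQuotientMap_quotient_mk'

theorem mk_eq_mk {x y : Pre} :
    mk x = mk y ↔ ∃ l : ℂ, l ≠ 0 ∧ y.1.1 = l • x.1.1 ∧ x.2 = l ^ 2 * y.2 :=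
  ⟨fun h => Quotient.exact (s := preSetoid) h, fun h => Quotient.sound (s := preSetoid) h⟩

/-- The exceptional curve `ℂP¹`, that is, the zero section. -/
def exceptional : Set KCP1 := {x | ∃ z : {z : ℂ × ℂ // z ≠ 0}, x = mk (z, 0)}

/-- The action of `ℤ₂ = {±1}` on `ℂ²`. -/
def signSetoid : Setoid (ℂ × ℂ) where
  r z w := w = z ∨ w = -z
  iseqv :=
    { refl := fun z => Or.inl rfl
      symm := by
        rintro z w (h | h)
        · exact Or.inl h.symm
        · exact Or.inr (by rw [h, neg_neg])
      trans := by
        rintro x y z (h | h) (h' | h')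
        · exact Or.inl (h'.trans h)
        · exact Or.inr (by rw [h', h])
        · exact Or.inr (by rw [h', h])
        · exact Or.inl (by rw [h', h, neg_neg]) }

/-- The orbifold `ℂ² / ℤ₂`. -/
def C2modZ2 : Type := Quotient signSetoid

/-- The projection `ℂ² → ℂ² / ℤ₂`. -/
def toOrbifold (z : ℂ × ℂ) : C2modZ2 := Quotient.mk signSetoid z

/-- The blow-down map `K_{ℂP¹} → ℂ² / ℤ₂`, `[z, t] ↦ ± √t z`. -/
def blowDown : KCP1 → C2modZ2 :=
  Quotient.lift (s := preSetoid) (fun x => toOrbifold ((x.2 ^ (1 / 2 : ℂ)) • x.1.1)) (by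
    rintro x y ⟨l, hl, h1, h2⟩
    apply Quotient.sound (s := signSetoid)
    have hs : ∀ t : ℂ, (t ^ (1 / 2 : ℂ)) ^ 2 = t := fun t => by
      have h := Complex.cpow_nat_inv_pow t (n := 2) two_ne_zero
      rwa [Nat.cast_ofNat, ← one_div] at h
    have h3 : (y.2 ^ (1 / 2 : ℂ) * l) ^ 2 = (x.2 ^ (1 / 2 : ℂ)) ^ 2 := by
      rw [mul_pow, hs, hs, h2]; ring
    rcases sq_eq_sq_iff_eq_or_eq_neg.mp h3 with h | h
    · left; simp only [h1, smul_smul, h]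
    · right; simp only [h1, smul_smul, h, neg_smul])

/-- The inverse of the blow-down map away from the exceptional curve: the image in `K_{ℂP¹}` of a
point `z ≠ 0` of `ℂ²`. (The value at `z = 0` is arbitrary.) -/
def liftPoint (z : ℂ × ℂ) : KCP1 :=
  open Classical in
  if h : z = 0 then mk (⟨(1, 0), by simp⟩, 0) else mk (⟨z, h⟩, 1)

/-! ### The complex structure -/

/-- `([z, t]) ↦ (t z₁², z₂ / z₁)`. -/
def coord (x : KCP1) : ℂ × ℂ :=
  Quotient.lift (s := preSetoid)
    (fun x : Pre => ((x.2 * x.1.1.1 ^ 2, x.1.1.2 / x.1.1.1) : ℂ × ℂ)) (by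
      rintro x y ⟨l, hl, h1, h2⟩
      simp only [h1, h2, Prod.smul_fst, Prod.smul_snd, smul_eq_mul, Prod.mk.injEq]
      exact ⟨by ring, (mul_div_mul_left _ _ hl).symm⟩) x

@[simp] theorem coord_mk (x : Pre) : coord (mk x) = (x.2 * x.1.1.1 ^ 2, x.1.1.2 / x.1.1.1) := rfl

/-- The part of `K_{ℂP¹}` lying over `{z₁ ≠ 0}`. -/
def dom0 : Set KCP1 := {x | ∃ y : Pre, x = mk y ∧ y.1.1.1 ≠ 0}

theorem mk_mem_dom0 (x : Pre) : mk x ∈ dom0 ↔ x.1.1.1 ≠ 0 := by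
  constructor
  · rintro ⟨y, hy, hy0⟩
    obtain ⟨l, hl, h1, -⟩ := mk_eq_mk.mp hy
    intro h
    apply hy0
    rw [h1, Prod.smul_fst, h, smul_zero]
  · exact fun h => ⟨x, rfl, h⟩

theorem isOpen_dom0 : IsOpen dom0 := by
  rw [← isQuotientMap_mk.isOpen_preimage]
  have : mk ⁻¹' dom0 = {x : Pre | x.1.1.1 ≠ 0} := by ext x; exact mk_mem_dom0 x
  rw [this]
  exact isOpen_ne_fun (by fun_prop) continuous_const

/-- The blow-up coordinates `(p, q)`, with `z₁ = p^{1/2}`, `z₂ = p^{1/2} q`, on the part of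
`K_{ℂP¹}` lying over `{z₁ ≠ 0}`. -/
def chart0 : OpenPartialHomeomorph KCP1 (ℂ × ℂ) where
  toFun := coord
  invFun y := mk (⟨(1, y.2), by simp⟩, y.1)
  source := dom0
  target := Set.univ
  map_source' _ _ := Set.mem_univ _
  map_target' y _ := (mk_mem_dom0 _).mpr one_ne_zero
  left_inv' := by
    rintro _ ⟨y, rfl, hy⟩
    rw [mk_eq_mk]
    refine ⟨y.1.1.1, hy, ?_, ?_⟩
    · ext <;> simp
      field_simp
    · simp; ring
  right_inv' y _ := by simp
  open_source := isOpen_dom0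
  open_target := isOpen_univ
  continuousOn_toFun := by
    rw [isQuotientMap_mk.continuousOn_isOpen_iff isOpen_dom0]
    have : coord ∘ mk = fun x : Pre => ((x.2 * x.1.1.1 ^ 2, x.1.1.2 / x.1.1.1) : ℂ × ℂ) := rfl
    rw [this]
    apply ContinuousOn.prodMk
    · exact Continuous.continuousOn (by fun_prop)
    · exact ContinuousOn.div (Continuous.continuousOn (by fun_prop))
        (Continuous.continuousOn (by fun_prop)) (fun x hx => (mk_mem_dom0 x).mp hx)
  continuousOn_invFun := by
    apply Continuous.continuousOn
    apply isQuotientMap_mk.continuous.comp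
    fun_prop

/-- `[(z₁, z₂), t] ↦ [(z₂, z₁), t]`. -/
def swapFun : KCP1 → KCP1 :=
  Quotient.lift (s := preSetoid)
    (fun x : Pre => mk (⟨x.1.1.swap, fun h => x.1.2 (by simpa using congrArg Prod.swap h)⟩, x.2))
    (by
      rintro x y ⟨l, hl, h1, h2⟩
      exact mk_eq_mk.mpr ⟨l, hl, by simp only [h1]; rfl, h2⟩)

theorem swapFun_swapFun (x : KCP1) : swapFun (swapFun x) = x := by
  induction x using Quotient.inductionOn
  rfl

theorem continuous_swapFun : Continuous swapFun := by
  rw [isQuotientMap_mk.continuous_iff]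
  have h : Continuous fun x : Pre =>
      ((⟨x.1.1.swap, fun h => x.1.2 (by simpa using congrArg Prod.swap h)⟩, x.2) : Pre) := by
    fun_prop
  exact isQuotientMap_mk.continuous.comp h

/-- The involution of `K_{ℂP¹}` that exchanges `z₁` and `z₂`. -/
def swap : KCP1 ≃ₜ KCP1 where
  toFun := swapFun
  invFun := swapFun
  left_inv := swapFun_swapFun
  right_inv := swapFun_swapFun
  continuous_toFun := continuous_swapFun
  continuous_invFun := continuous_swapFun

/-- The blow-up coordinates `(p', q') = (t z₂², z₁ / z₂)` on the part of `K_{ℂP¹}` lying over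
`{z₂ ≠ 0}`. -/
def chart1 : OpenPartialHomeomorph KCP1 (ℂ × ℂ) := swap.toOpenPartialHomeomorph.trans chart0

theorem chart1_mk (x : Pre) : chart1 (mk x) = (x.2 * x.1.1.2 ^ 2, x.1.1.1 / x.1.1.2) := rfl

theorem mk_mem_chart1_source (x : Pre) : mk x ∈ chart1.source ↔ x.1.1.2 ≠ 0 := by
  have h : mk x ∈ chart1.source ↔ swapFun (mk x) ∈ dom0 := by
    simp [chart1, swap, chart0]
  rw [h]
  exact mk_mem_dom0 _

theorem mem_chart1_source_of_notMem {x : KCP1} (h : x ∉ chart0.source) : x ∈ chart1.source := by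
  induction x using Quotient.inductionOn with
  | h y =>
    change mk y ∉ dom0 at h
    refine (mk_mem_chart1_source y).mpr fun h2 => y.1.2 ?_
    rw [mk_mem_dom0, not_not] at h
    exact Prod.ext h h2

instance : ChartedSpace (ℂ × ℂ) KCP1 where
  atlas := {chart0, chart1}
  chartAt x := open Classical in if x ∈ chart0.source then chart0 else chart1
  mem_chart_source x := by
    split_ifs with h
    · exact h
    · exact mem_chart1_source_of_notMem h
  chart_mem_atlas x := by split_ifs <;> simp

theorem transition (y : ℂ × ℂ) :
    chart1 (chart0.symm y) = (y.1 * y.2 ^ 2, y.2⁻¹) ∧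
      chart0 (chart1.symm y) = (y.1 * y.2 ^ 2, y.2⁻¹) := by
  constructor
  · change chart1 (mk (⟨(1, y.2), by simp⟩, y.1)) = _
    simp [chart1_mk]
  · change coord (mk (⟨(y.2, 1), by simp⟩, y.1)) = _
    simp

theorem transition_source {y : ℂ × ℂ} :
    (y ∈ (chart0.symm.trans chart1).source → y.2 ≠ 0) ∧
      (y ∈ (chart1.symm.trans chart0).source → y.2 ≠ 0) := by
  constructor
  · intro h
    exact (mk_mem_chart1_source (⟨(1, y.2), by simp⟩, y.1)).mp h.2
  · intro h
    exact (mk_mem_dom0 (⟨(y.2, 1), by simp⟩, y.1)).mp h.2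

/-- `K_{ℂP¹}` is a complex manifold of dimension two. -/
instance : IsManifold 𝓘(ℂ, ℂ × ℂ) ω KCP1 := by
  have hne : ∀ y : ℂ × ℂ, y.2 ≠ 0 →
      ContDiffAt ℂ ω (fun y : ℂ × ℂ => ((y.1 * y.2 ^ 2, y.2⁻¹) : ℂ × ℂ)) y := fun y hy =>
    ContDiffAt.prodMk (ContDiff.contDiffAt (by fun_prop)) (contDiffAt_snd.inv hy)
  apply isManifold_of_contDiffOn
  have aux : ∀ e : OpenPartialHomeomorph KCP1 (ℂ × ℂ),
      ContDiffOn ℂ ω (e.symm.trans e) (e.symm.trans e).source := fun e =>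
    contDiffOn_id.congr fun y hy => e.right_inv hy.1
  have h01 : ContDiffOn ℂ ω (chart0.symm.trans chart1) (chart0.symm.trans chart1).source :=
    fun y hy => ((hne y (transition_source.1 hy)).congr_of_eventuallyEq
      (Filter.Eventually.of_forall fun z => (transition z).1)).contDiffWithinAt
  have h10 : ContDiffOn ℂ ω (chart1.symm.trans chart0) (chart1.symm.trans chart0).source :=
    fun y hy => ((hne y (transition_source.2 hy)).congr_of_eventuallyEq
      (Filter.Eventually.of_forall fun z => (transition z).2)).contDiffWithinAt
  intro e e' he he'
  simp only [modelWithCornersSelf_coe, modelWithCornersSelf_coe_symm, Set.preimage_id,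
    Set.range_id, Set.inter_univ, Function.id_comp, Function.comp_id]
  rcases he with rfl | rfl <;> rcases he' with rfl | rfl
  · exact aux _
  · exact h01
  · exact h10
  · exact aux _

/-- The underlying real manifold, of dimension four. -/
instance : IsManifold 𝓘(ℝ, ℂ × ℂ) ω KCP1 := by
  apply isManifold_of_contDiffOn
  intro e e' he he'
  have h := ((contDiffGroupoid ω 𝓘(ℂ, ℂ × ℂ)).compatible he he')
  rw [contDiffGroupoid, mem_groupoid_of_pregroupoid] at h
  exact h.1.restrict_scalars ℝ

/-- A continuous injective map to a Hausdorff space. -/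
def toHausdorff : KCP1 → ℂ × ℂ × ℂ × ℂ :=
  Quotient.lift (s := preSetoid)
    (fun x : Pre => (x.2 * x.1.1.1 ^ 2, x.2 * x.1.1.2 ^ 2,
      x.1.1.1 * star x.1.1.2 / ((‖x.1.1.1‖ ^ 2 + ‖x.1.1.2‖ ^ 2 : ℝ) : ℂ),
      x.1.1.1 * star x.1.1.1 / ((‖x.1.1.1‖ ^ 2 + ‖x.1.1.2‖ ^ 2 : ℝ) : ℂ))) (by
      rintro x y ⟨l, hl, h1, h2⟩
      have hn : ((‖l‖ ^ 2 : ℝ) : ℂ) ≠ 0 := by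
        simpa using hl
      have hll : l * star l = ((‖l‖ ^ 2 : ℝ) : ℂ) := by
        simpa using Complex.mul_conj' l
      have hs : ((‖l * x.1.1.1‖ ^ 2 + ‖l * x.1.1.2‖ ^ 2 : ℝ) : ℂ) =
          ((‖l‖ ^ 2 : ℝ) : ℂ) * ((‖x.1.1.1‖ ^ 2 + ‖x.1.1.2‖ ^ 2 : ℝ) : ℂ) := by
        push_cast [norm_mul]; ring
      simp only [h1, h2, Prod.smul_fst, Prod.smul_snd, smul_eq_mul, Prod.mk.injEq, star_mul']
      refine ⟨by ring, by ring, ?_, ?_⟩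
      · rw [hs, mul_mul_mul_comm, hll, mul_div_mul_left _ _ hn]
      · rw [hs, mul_mul_mul_comm, hll, mul_div_mul_left _ _ hn])

theorem sum_norm_ne_zero (x : Pre) : ((‖x.1.1.1‖ ^ 2 + ‖x.1.1.2‖ ^ 2 : ℝ) : ℂ) ≠ 0 := by
  rw [Complex.ofReal_ne_zero]
  intro h
  apply x.1.2
  have h1 : ‖x.1.1.1‖ ^ 2 = 0 := by nlinarith [sq_nonneg ‖x.1.1.1‖, sq_nonneg ‖x.1.1.2‖]
  have h2 : ‖x.1.1.2‖ ^ 2 = 0 := by nlinarith [sq_nonneg ‖x.1.1.1‖, sq_nonneg ‖x.1.1.2‖]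
  exact Prod.ext (by simpa using h1) (by simpa using h2)

/-- `K_{ℂP¹}` is Hausdorff. -/
instance : T2Space KCP1 := by
  refine T2Space.of_injective_continuous (f := toHausdorff) ?_ ?_
  · intro x y
    induction x using Quotient.inductionOn with
    | h x =>
    induction y using Quotient.inductionOn with
    | h y =>
    intro h
    change mk x = mk y
    have hx := sum_norm_ne_zero x
    have hy := sum_norm_ne_zero y
    have h' : (_ : ℂ × ℂ × ℂ × ℂ) = _ := h
    simp only [toHausdorff, Quotient.lift_mk, Prod.mk.injEq] at h'
    obtain ⟨e1, e2, e3, e4⟩ := h'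
    by_cases hx1 : x.1.1.1 = 0
    · have hy1 : y.1.1.1 = 0 := by
        rw [hx1, zero_mul, zero_div, eq_comm, div_eq_zero_iff, or_iff_left hy] at e4
        simpa using e4
      have hx2 : x.1.1.2 ≠ 0 := fun h2 => x.1.2 (Prod.ext hx1 h2)
      have hy2 : y.1.1.2 ≠ 0 := fun h2 => y.1.2 (Prod.ext hy1 h2)
      apply chart1.injOn ((mk_mem_chart1_source x).mpr hx2) ((mk_mem_chart1_source y).mpr hy2)
      rw [chart1_mk, chart1_mk, e2, hx1, hy1, zero_div, zero_div]
    · have hy1 : y.1.1.1 ≠ 0 := by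
        intro hy1
        rw [hy1, zero_mul, zero_div, div_eq_zero_iff, or_iff_left hx] at e4
        exact hx1 (by simpa using e4)
      apply chart0.injOn ((mk_mem_dom0 x).mpr hx1) ((mk_mem_dom0 y).mpr hy1)
      change (_, _) = (_, _)
      rw [e1]
      refine Prod.ext rfl ?_
      have hx1' : star x.1.1.1 ≠ 0 := by simpa using hx1
      have hy1' : star y.1.1.1 ≠ 0 := by simpa using hy1
      change x.1.1.2 / x.1.1.1 = y.1.1.2 / y.1.1.1
      have key : star (x.1.1.2) / star x.1.1.1 = star y.1.1.2 / star y.1.1.1 := by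
        have ex : star (x.1.1.2) / star x.1.1.1 =
            (x.1.1.1 * star x.1.1.2 / ((‖x.1.1.1‖ ^ 2 + ‖x.1.1.2‖ ^ 2 : ℝ) : ℂ)) /
            (x.1.1.1 * star x.1.1.1 / ((‖x.1.1.1‖ ^ 2 + ‖x.1.1.2‖ ^ 2 : ℝ) : ℂ)) := by
          rw [div_div_div_cancel_right₀ hx, mul_div_mul_left _ _ hx1]
        have ey : star (y.1.1.2) / star y.1.1.1 =
            (y.1.1.1 * star y.1.1.2 / ((‖y.1.1.1‖ ^ 2 + ‖y.1.1.2‖ ^ 2 : ℝ) : ℂ)) /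
            (y.1.1.1 * star y.1.1.1 / ((‖y.1.1.1‖ ^ 2 + ‖y.1.1.2‖ ^ 2 : ℝ) : ℂ)) := by
          rw [div_div_div_cancel_right₀ hy, mul_div_mul_left _ _ hy1]
        rw [ex, ey, e3, e4]
      rw [← star_div₀, ← star_div₀] at key
      exact star_injective key
  · rw [isQuotientMap_mk.continuous_iff]
    have hc : ∀ g : Pre → ℂ, Continuous g →
        Continuous fun x => g x / ((‖x.1.1.1‖ ^ 2 + ‖x.1.1.2‖ ^ 2 : ℝ) : ℂ) := fun g hg =>
      hg.div (by fun_prop) sum_norm_ne_zero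
    exact Continuous.prodMk (by fun_prop) (Continuous.prodMk (by fun_prop)
      (Continuous.prodMk (hc _ (by fun_prop)) (hc _ (by fun_prop))))

/-! ### Two-forms -/

/-- The wedge product `α ∧ β` of two complex-valued one-forms. -/
def wedge {E : Type*} [AddCommGroup E] [Module ℝ E] [TopologicalSpace E] (α β : E →L[ℝ] ℂ) :
    E [⋀^Fin 2]→L[ℝ] ℂ where
  toFun v := α (v 0) * β (v 1) - α (v 1) * β (v 0)
  map_update_add' v i x y := by
    fin_cases i <;> simp <;> ring
  map_update_smul' v i c x := by
    fin_cases i <;> simp <;> ring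
  map_eq_zero_of_eq' v i j h hij := by
    fin_cases i <;> fin_cases j <;> simp_all
  cont := by fun_prop

/-- The complex conjugate of a complex-valued one-form. -/
def bar {E : Type*} [AddCommGroup E] [Module ℝ E] [TopologicalSpace E] (α : E →L[ℝ] ℂ) :
    E →L[ℝ] ℂ := (Complex.conjCLE : ℂ →L[ℝ] ℂ).comp α

/-- The differential of the first complex coordinate of `ℂ²`. -/
def d1 : ℂ × ℂ →L[ℝ] ℂ := ContinuousLinearMap.fst ℝ ℂ ℂ

/-- The differential of the second complex coordinate of `ℂ²`. -/
def d2 : ℂ × ℂ →L[ℝ] ℂ := ContinuousLinearMap.snd ℝ ℂ ℂ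

/-- A differential two-form on `K_{ℂP¹}` with values in `F`, as a field of alternating maps on the
real tangent spaces. -/
abbrev TwoForm (F : Type) [AddCommGroup F] [Module ℝ F] [TopologicalSpace F] : Type :=
  (x : KCP1) → TangentSpace 𝓘(ℝ, ℂ × ℂ) x [⋀^Fin 2]→L[ℝ] F

/-- The pull-back `f^* η` at the point `y`. -/
def pullback {F : Type} [AddCommGroup F] [Module ℝ F] [TopologicalSpace F]
    {E H M : Type} [NormedAddCommGroup E] [NormedSpace ℝ E] [TopologicalSpace H]
    (I : ModelWithCorners ℝ E H) [TopologicalSpace M] [ChartedSpace H M]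
    (f : M → KCP1) (η : TwoForm F) (y : M) : TangentSpace I y [⋀^Fin 2]→L[ℝ] F :=
  (η (f y)).compContinuousLinearMap (mfderiv I 𝓘(ℝ, ℂ × ℂ) f y)

/-- The expression of a two-form in a coordinate chart. -/
def inChart {F : Type} [AddCommGroup F] [Module ℝ F] [TopologicalSpace F]
    (η : TwoForm F) (e : OpenPartialHomeomorph KCP1 (ℂ × ℂ)) (y : ℂ × ℂ) :
    (ℂ × ℂ) [⋀^Fin 2]→L[ℝ] F :=
  pullback 𝓘(ℝ, ℂ × ℂ) e.symm η y

/-- The two-form on `K_{ℂP¹}` that is given by `η₀` in the coordinates `chart0` and, where these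
are not defined, by `η₁` in the coordinates `chart1`. -/
def ofCharts {F : Type} [AddCommGroup F] [Module ℝ F] [TopologicalSpace F]
    (η₀ η₁ : ℂ × ℂ → (ℂ × ℂ) [⋀^Fin 2]→L[ℝ] F) : TwoForm F := fun x =>
  open Classical in
  if x ∈ chart0.source then
    (η₀ (chart0 x)).compContinuousLinearMap (mfderiv 𝓘(ℝ, ℂ × ℂ) 𝓘(ℝ, ℂ × ℂ) chart0 x)
  else
    (η₁ (chart1 x)).compContinuousLinearMap (mfderiv 𝓘(ℝ, ℂ × ℂ) 𝓘(ℝ, ℂ × ℂ) chart1 x)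

/-- The complex structure of `K_{ℂP¹}` on its tangent spaces: multiplication by `i` in the
holomorphic chart that trivializes the tangent space. -/
def J (x : KCP1) : TangentSpace 𝓘(ℝ, ℂ × ℂ) x →L[ℝ] TangentSpace 𝓘(ℝ, ℂ × ℂ) x :=
  (Complex.I • ContinuousLinearMap.id ℝ (ℂ × ℂ) : ℂ × ℂ →L[ℝ] ℂ × ℂ)

/-! ### The Eguchi–Hanson structure -/

/-- `U = |z₁|² + |z₂|²`. -/
def U (z : ℂ × ℂ) : ℝ := ‖z.1‖ ^ 2 + ‖z.2‖ ^ 2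

/-- `∂U = z̄₁ dz₁ + z̄₂ dz₂`. -/
def delU (z : ℂ × ℂ) : ℂ × ℂ →L[ℝ] ℂ := star z.1 • d1 + star z.2 • d2

/-- `∂∂̄U = dz₁ ∧ dz̄₁ + dz₂ ∧ dz̄₂`. -/
def delbarU : (ℂ × ℂ) [⋀^Fin 2]→L[ℝ] ℂ := wedge d1 (bar d1) + wedge d2 (bar d2)

/-- The Eguchi–Hanson form on `ℂ² \ {0}`, which is `i ∂∂̄ f(U)` with `f'(U) = √(U² + a²) / U`:
`i / (U² √(U² + a²)) [(U² + a²) U ∂∂̄U - a² ∂U ∧ ∂̄U]`. -/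
def flatEH (a : ℝ) (z : ℂ × ℂ) : (ℂ × ℂ) [⋀^Fin 2]→L[ℝ] ℂ :=
  (Complex.I / ((U z ^ 2 * √(U z ^ 2 + a ^ 2) : ℝ) : ℂ)) •
    ((((U z ^ 2 + a ^ 2) * U z : ℝ) : ℂ) • delbarU -
      ((a ^ 2 : ℝ) : ℂ) • wedge (delU z) (bar (delU z)))

/-- The Eguchi–Hanson form in the blow-up coordinates `(p, q)`. With `h = 1 + |q|²`, `U = |p| h` and
`θ = (h / 2) dp + p q̄ dq` it is
`i (√(U² + a²) / h² dq ∧ dq̄ + 1 / √(U² + a²) θ ∧ θ̄)`. -/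
def chartEH (a : ℝ) (y : ℂ × ℂ) : (ℂ × ℂ) [⋀^Fin 2]→L[ℝ] ℝ :=
  let h : ℝ := 1 + ‖y.2‖ ^ 2
  let r : ℝ := √((‖y.1‖ * h) ^ 2 + a ^ 2)
  let θ : ℂ × ℂ →L[ℝ] ℂ := ((h / 2 : ℝ) : ℂ) • d1 + (y.1 * star y.2) • d2
  Complex.reCLM.compContinuousAlternatingMap
    (Complex.I • (((r / h ^ 2 : ℝ) : ℂ) • wedge d2 (bar d2) +
      ((1 / r : ℝ) : ℂ) • wedge θ (bar θ)))

/-- The Eguchi–Hanson form on `K_{ℂP¹}`. -/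
def omega (a : ℝ) : TwoForm ℝ := ofCharts (chartEH a) (chartEH a)

/-- The holomorphic two-form `Ω` on `K_{ℂP¹}` induced from `dz₁ ∧ dz₂`: it is `½ dp ∧ dq` in
`chart0` and `-½ dp' ∧ dq'` in `chart1`. -/
def Omega : TwoForm ℂ :=
  ofCharts (fun _ => (1 / 2 : ℂ) • wedge d1 d2) (fun _ => (-1 / 2 : ℂ) • wedge d1 d2)

/-- `η` is the fundamental form of a Kähler metric on `K_{ℂP¹}`; the metric is
`g(v, w) = η(v, J w)`. -/
structure IsKaehlerForm (η : TwoForm ℝ) : Prop where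
  smooth : ∀ e ∈ atlas (ℂ × ℂ) KCP1, ContDiffOn ℝ ∞ (inChart η e) e.target
  closed : ∀ e ∈ atlas (ℂ × ℂ) KCP1, ∀ y ∈ e.target, extDeriv (inChart η e) y = 0
  map_J : ∀ x v w, η x ![J x v, J x w] = η x ![v, w]
  pos : ∀ x v, v ≠ 0 → 0 < η x ![v, J x v]

/-- The Hermitian matrix `(g_{jk̄})` in holomorphic coordinates of a Kähler form
`i ∑ g_{jk̄} dz_j ∧ dz̄_k`. -/
def hermMatrix (η : TwoForm ℝ) (e : OpenPartialHomeomorph KCP1 (ℂ × ℂ)) (y : ℂ × ℂ) :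
    Matrix (Fin 2) (Fin 2) ℂ :=
  let b : Fin 2 → ℂ × ℂ := ![(1, 0), (0, 1)]
  Matrix.of fun j k =>
    ((inChart η e y ![b j, Complex.I • b k] : ℝ) - Complex.I * (inChart η e y ![b j, b k] : ℝ)) / 2

/-- The form `i ∂∂̄ u` on `ℂ²` at `y`, evaluated at `(v, w)`: with the second derivative `D²u` this is
`½ (D²u(i v, w) - D²u(v, i w))`. -/
def ddbar (u : ℂ × ℂ → ℝ) (y v w : ℂ × ℂ) : ℝ :=
  (fderiv ℝ (fderiv ℝ u) y (Complex.I • v) w - fderiv ℝ (fderiv ℝ u) y v (Complex.I • w)) / 2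

/-- The Ricci form `-i ∂∂̄ log det (g_{jk̄})` of a Kähler metric, in a chart. -/
def ricciForm (η : TwoForm ℝ) (e : OpenPartialHomeomorph KCP1 (ℂ × ℂ)) (y v w : ℂ × ℂ) : ℝ :=
  -ddbar (fun y' => Real.log (hermMatrix η e y').det.re) y v w

/-- The Kähler metric with form `η` is Ricci-flat. -/
def IsRicciFlat (η : TwoForm ℝ) : Prop :=
  ∀ e ∈ atlas (ℂ × ℂ) KCP1, ∀ y ∈ e.target, ∀ v w, ricciForm η e y v w = 0

/-- `Θ` is a nowhere vanishing holomorphic `(2,0)`-form on `K_{ℂP¹}`. -/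
def IsHolomorphicVolumeForm (Θ : TwoForm ℂ) : Prop :=
  ∀ e ∈ atlas (ℂ × ℂ) KCP1, ∃ h : ℂ × ℂ → ℂ, DifferentiableOn ℂ h e.target ∧
    ∀ y ∈ e.target, h y ≠ 0 ∧ inChart Θ e y = h y • wedge d1 d2

/-- `η ∧ η = 2 Θ ∧ Θ̄`, evaluated on four tangent vectors. -/
def IsNormalized (η : TwoForm ℝ) (Θ : TwoForm ℂ) : Prop :=
  ∀ (x : KCP1) (v : Fin 4 → TangentSpace 𝓘(ℝ, ℂ × ℂ) x),
    let p : Fin 4 → Fin 4 → ℂ := fun j k => (η x ![v j, v k] : ℝ)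
    let q : Fin 4 → Fin 4 → ℂ := fun j k => Θ x ![v j, v k]
    2 * (p 0 1 * p 2 3 - p 0 2 * p 1 3 + p 0 3 * p 1 2) =
      2 * (q 0 1 * star (q 2 3) - q 0 2 * star (q 1 3) + q 0 3 * star (q 1 2) +
        q 1 2 * star (q 0 3) - q 1 3 * star (q 0 2) + q 2 3 * star (q 0 1))

/-! ### The submanifolds -/

/-- The plane `u₁ + i u₂ = (b + i c)(v₂ + i v₁)` in `ℂ²`, where `z_j = u_j + i v_j`. -/
def plane (b c : ℝ) : Set (ℂ × ℂ) :=
  {z | (z.1.re : ℂ) + Complex.I * z.2.re =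
    ((b : ℂ) + Complex.I * c) * (z.2.im + Complex.I * z.1.im)}

/-- The submanifold `L_{bc}` of `K_{ℂP¹}`, which extends the image of the plane across the
exceptional curve: over the complex line through a point `z ≠ 0` of the plane it is the real line
spanned by `z ⊗ z`. -/
def extension (b c : ℝ) : Set KCP1 :=
  {x | ∃ z : {z : ℂ × ℂ // z ≠ 0}, z.1 ∈ plane b c ∧ ∃ t : ℝ, x = mk (z, (t : ℂ))}

/-- `f` is a closed smooth embedding: a smooth map with injective differentials which is a
homeomorphism onto a closed subset. -/
structure IsClosedSmoothEmbedding {E H M : Type} [NormedAddCommGroup E] [NormedSpace ℝ E]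
    [TopologicalSpace H] (I : ModelWithCorners ℝ E H) [TopologicalSpace M] [ChartedSpace H M]
    (f : M → KCP1) : Prop where
  smooth : ContMDiff I 𝓘(ℝ, ℂ × ℂ) ∞ f
  immersion : ∀ y, Function.Injective (mfderiv I 𝓘(ℝ, ℂ × ℂ) f y)
  closedEmbedding : Topology.IsClosedEmbedding f

/-- The image of the immersion `f` of a surface is special Lagrangian with respect to the Kähler form
`η` and the holomorphic volume form `Θ`: `f^* η = 0` and `f^* Im Θ = 0`. -/
def IsSpecialLagrangian {E H M : Type} [NormedAddCommGroup E] [NormedSpace ℝ E]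
    [TopologicalSpace H] (I : ModelWithCorners ℝ E H) [TopologicalSpace M] [ChartedSpace H M]
    (f : M → KCP1) (η : TwoForm ℝ) (Θ : TwoForm ℂ) : Prop :=
  Module.finrank ℝ E = 2 ∧
    ∀ (y : M) (v w : TangentSpace I y),
      pullback I f η y ![v, w] = 0 ∧ (pullback I f Θ y ![v, w]).im = 0

end EguchiHanson

end

noncomputable section

namespace EguchiHanson

open Complex ComplexConjugate Topology

/-! In blow-up coordinates `(p, q)` the Eguchi–Hanson form is `i (r h⁻² dq ∧ dq̄ + r⁻¹ θ ∧ θ̄)`,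
with `r = √(U² + a²)`. It is diagonal in the `(1,0)`-coframe `(dq, θ)`, with positive coefficients,
which gives `J`-invariance and positivity (`chartEH_I_smul`, `chartEH_pos`). Since `θ ∧ dq = (h / 2)
dp ∧ dq`, the factors `r` and `h` cancel from the determinant, which is the constant `1/4`. This
yields both Ricci-flatness (`chartEH_det`) and the normalization against `Ω = ± ½ dp ∧ dq`
(`chartEH_normalized`). Closedness is a computation with directional derivatives
(`extDeriv_chartEH`).

The other chart and `ℂ² \ {0}` are reached by explicit maps that change `θ` only by a factor of
modulus one: `theta_transition` and `theta_square`, where `θ` becomes `∂U`.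

The plane is the real span of `(i - c, b)` and `(b, i + c)`. On it `z̄ · z'` and `z₁ z₂' - z₂ z₁'`
are real, and the second vanishes only on real-dependent pairs. The surface `L_{bc}` is ruled by the
real lines `ℝ z ⊗ z`, so it is parametrized by `(w², s)`, with `w` the unit vector of imaginary
parts of `z`. Along it `q = z₂ / z₁` does not depend on `s`, and `θ` is real up to a common phase,
so each summand of `ω` vanishes (`chartEH_ruledDeriv`). The reality of the determinant kills `Im Ω`,
and its nonvanishing makes the parametrization an immersion, also at `s = 0`. A continuous function
on `K_{ℂP¹}` recovers `s`, so the parametrization is proper (`isClosedEmbedding_param`).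
Differentials are computed after lifting to `ℝ × ℝ`, where `w = e^{iφ}` is a smooth square root.

For the covering, every point off `E` is `[z, 1]`. The equation of the plane can be solved for `b +
ic` unless `z` is real, and then `i z` lies in the plane with `b = c = 0`. -/

@[simp] theorem wedge_apply {E : Type*} [AddCommGroup E] [Module ℝ E] [TopologicalSpace E]
    (α β : E →L[ℝ] ℂ) (v : Fin 2 → E) : wedge α β v = α (v 0) * β (v 1) - α (v 1) * β (v 0) := rfl

@[simp] theorem bar_apply {E : Type*} [AddCommGroup E] [Module ℝ E] [TopologicalSpace E]
    (α : E →L[ℝ] ℂ) (v : E) : bar α v = conj (α v) := rfl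

@[simp] theorem d1_apply (v : ℂ × ℂ) : d1 v = v.1 := rfl

@[simp] theorem d2_apply (v : ℂ × ℂ) : d2 v = v.2 := rfl

/-! ### Pointwise algebra of the Eguchi–Hanson form in a chart. -/

/-- `h = 1 + |q|²`. -/
def height (q : ℂ) : ℝ := 1 + ‖q‖ ^ 2

theorem height_pos (q : ℂ) : 0 < height q := by unfold height; positivity

theorem ofReal_height (q : ℂ) : (height q : ℂ) = 1 + q * conj q := by
  rw [height, Complex.mul_conj']; push_cast; rfl

/-- `√(U² + a²)` in the blow-up coordinates. -/
def rad (a : ℝ) (y : ℂ × ℂ) : ℝ := √((‖y.1‖ * height y.2) ^ 2 + a ^ 2)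

theorem rad_pos {a : ℝ} (ha : 0 < a) (y : ℂ × ℂ) : 0 < rad a y :=
  Real.sqrt_pos.mpr (by positivity)

/-- The one-form `θ = (h / 2) dp + p q̄ dq`. -/
def theta (y : ℂ × ℂ) : ℂ × ℂ →L[ℝ] ℂ :=
  ((height y.2 / 2 : ℝ) : ℂ) • d1 + (y.1 * star y.2) • d2

theorem theta_apply (y v : ℂ × ℂ) :
    theta y v = (height y.2 / 2 : ℝ) * v.1 + y.1 * conj y.2 * v.2 := rfl

theorem chartEH_eq (a : ℝ) (y : ℂ × ℂ) : chartEH a y =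
    Complex.reCLM.compContinuousAlternatingMap
    (Complex.I • (((rad a y / height y.2 ^ 2 : ℝ) : ℂ) • wedge d2 (bar d2) +
      ((1 / rad a y : ℝ) : ℂ) • wedge (theta y) (bar (theta y)))) := rfl

theorem re_I_mul_sub_conj (A B : ℝ) (x y z w : ℂ) :
    (I * (A * (x * conj y - y * conj x) + B * (z * conj w - w * conj z))).re =
      -2 * (A * (x * conj y).im + B * (z * conj w).im) := by
  simp; ring

theorem chartEH_apply (a : ℝ) (y v w : ℂ × ℂ) : chartEH a y ![v, w] =
    -2 * (rad a y / height y.2 ^ 2 * (v.2 * conj w.2).im +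
      1 / rad a y * (theta y v * conj (theta y w)).im) :=
  re_I_mul_sub_conj _ _ _ _ _ _

/-- The bracket is purely imaginary, so the real part in `chartEH` can be dropped. This version
serves the computations by `field_simp` and `ring` over `ℂ`. -/
theorem ofReal_chartEH_apply (a : ℝ) (y v w : ℂ × ℂ) : (chartEH a y ![v, w] : ℂ) =
    I * ((rad a y / height y.2 ^ 2 : ℝ) * (v.2 * conj w.2 - w.2 * conj v.2) +
      (1 / rad a y : ℝ) * (theta y v * conj (theta y w) - theta y w * conj (theta y v))) := by
  rw [chartEH_apply, ← re_I_mul_sub_conj]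
  generalize rad a y / height y.2 ^ 2 = A
  generalize 1 / rad a y = B
  apply Complex.ext
  · simp
  · simp; ring

/-- The derivative of the coordinate change `(p, q) ↦ (p q², q⁻¹)`. -/
def transitionDeriv (y v : ℂ × ℂ) : ℂ × ℂ :=
  (y.2 ^ 2 * v.1 + 2 * y.1 * y.2 * v.2, -v.2 / y.2 ^ 2)

/-- Factors of modulus one do not affect `Im (x ȳ)`. This takes care of the phase of `θ` under the
coordinate change, and of multiplication by `i`. -/
theorem im_mul_conj_of_smul {c x y x' y' : ℂ} (hx : x' = c * x) (hy : y' = c * y) :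
    (x' * conj y').im = ‖c‖ ^ 2 * (x * conj y).im := by
  have : x' * conj y' = ((‖c‖ ^ 2 : ℝ) : ℂ) * (x * conj y) := by
    rw [hx, hy, map_mul, Complex.ofReal_pow, ← Complex.mul_conj']; ring
  rw [this, Complex.im_ofReal_mul]

theorem norm_div_conj {q : ℂ} (hq : q ≠ 0) : ‖q / conj q‖ = 1 := by
  rw [norm_div, RCLike.norm_conj, div_self (norm_ne_zero_iff.mpr hq)]

theorem height_inv {q : ℂ} (hq : q ≠ 0) : height q⁻¹ = height q / ‖q‖ ^ 2 := by
  have : ‖q‖ ≠ 0 := norm_ne_zero_iff.mpr hq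
  rw [height, height, norm_inv]; field_simp; ring

theorem rad_transition (a : ℝ) {y : ℂ × ℂ} (hq : y.2 ≠ 0) :
    rad a (y.1 * y.2 ^ 2, y.2⁻¹) = rad a y := by
  have : ‖y.2‖ ≠ 0 := norm_ne_zero_iff.mpr hq
  have : ‖y.1 * y.2 ^ 2‖ * (height y.2 / ‖y.2‖ ^ 2) = ‖y.1‖ * height y.2 := by
    rw [norm_mul, norm_pow]; field_simp
  simp only [rad, height_inv hq, this]

theorem theta_transition {y : ℂ × ℂ} (hq : y.2 ≠ 0) (v : ℂ × ℂ) :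
    theta (y.1 * y.2 ^ 2, y.2⁻¹) (transitionDeriv y v) = y.2 / conj y.2 * theta y v := by
  have hq' : conj y.2 ≠ 0 := by simpa using hq
  simp only [theta_apply, transitionDeriv, ofReal_div, ofReal_height, map_inv₀]
  field_simp
  push_cast
  ring

/-- The phase `q / q̄` of `θ` disappears. The factor `|q|⁻⁴` from `dq ∧ dq̄` is cancelled by the
change of `h⁻²`, while `r` is invariant. -/
theorem chartEH_transition (a : ℝ) {y : ℂ × ℂ} (hq : y.2 ≠ 0) (v w : ℂ × ℂ) :
    chartEH a (y.1 * y.2 ^ 2, y.2⁻¹) ![transitionDeriv y v, transitionDeriv y w] =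
      chartEH a y ![v, w] := by
  have hn : ‖y.2‖ ≠ 0 := norm_ne_zero_iff.mpr hq
  have hh := (height_pos y.2).ne'
  have h2 : ∀ v : ℂ × ℂ, (transitionDeriv y v).2 = -(y.2 ^ 2)⁻¹ * v.2 := fun v => by
    simp only [transitionDeriv]; ring
  rw [chartEH_apply, chartEH_apply, rad_transition a hq, height_inv hq,
    im_mul_conj_of_smul (theta_transition hq v) (theta_transition hq w),
    im_mul_conj_of_smul (h2 v) (h2 w), norm_div_conj hq, norm_neg, norm_inv, norm_pow]
  field_simp

/-- The Jacobian determinant is `q² · (-q⁻²) = -1`. Hence the opposite signs of `Ω` in the two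
charts. -/
theorem wedge_transition {y : ℂ × ℂ} (hq : y.2 ≠ 0) (v w : ℂ × ℂ) :
    wedge d1 d2 ![transitionDeriv y v, transitionDeriv y w] = -wedge d1 d2 ![v, w] := by
  simp [transitionDeriv]
  field_simp
  ring

theorem theta_I_smul (y v : ℂ × ℂ) : theta y (I • v) = I * theta y v := by
  simp only [theta_apply, Prod.smul_fst, Prod.smul_snd, smul_eq_mul]; ring

theorem chartEH_I_smul (a : ℝ) (y v w : ℂ × ℂ) :
    chartEH a y ![I • v, I • w] = chartEH a y ![v, w] := by
  have h2 : ∀ v : ℂ × ℂ, (I • v).2 = I * v.2 := fun v => rfl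
  rw [chartEH_apply, chartEH_apply,
    im_mul_conj_of_smul (theta_I_smul y v) (theta_I_smul y w),
    im_mul_conj_of_smul (h2 v) (h2 w), norm_I, one_pow, one_mul, one_mul]

theorem chartEH_pos {a : ℝ} (ha : 0 < a) (y : ℂ × ℂ) {v : ℂ × ℂ} (hv : v ≠ 0) :
    0 < chartEH a y ![v, I • v] := by
  have h2 : (I • v).2 = I * v.2 := rfl
  have him : ∀ x : ℂ, (x * conj (I * x)).im = -‖x‖ ^ 2 := fun x => by
    rw [map_mul, conj_I, mul_left_comm, Complex.mul_conj']
    simp [← ofReal_pow]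
  rw [chartEH_apply, theta_I_smul, h2, him, him]
  have hr := rad_pos ha y
  have hh := height_pos y.2
  rcases eq_or_ne v.2 0 with h | h
  · have h1 : v.1 ≠ 0 := fun h1 => hv (Prod.ext h1 h)
    have ht : theta y v ≠ 0 := by
      rw [theta_apply, h, mul_zero, add_zero]
      exact mul_ne_zero (by exact_mod_cast (half_pos hh).ne') h1
    have : 0 < ‖theta y v‖ := norm_pos_iff.mpr ht
    have : 0 < 1 / rad a y * ‖theta y v‖ ^ 2 := by positivity
    have : 0 ≤ rad a y / height y.2 ^ 2 * ‖v.2‖ ^ 2 := by positivity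
    linarith
  · have : 0 < ‖v.2‖ := norm_pos_iff.mpr h
    have : 0 ≤ 1 / rad a y * ‖theta y v‖ ^ 2 := by positivity
    have : 0 < rad a y / height y.2 ^ 2 * ‖v.2‖ ^ 2 := by positivity
    linarith

theorem ofReal_rad_ne_zero {a : ℝ} (ha : 0 < a) (y : ℂ × ℂ) : (rad a y : ℂ) ≠ 0 :=
  ofReal_ne_zero.mpr (rad_pos ha y).ne'

theorem ofReal_height_ne_zero (q : ℂ) : (height q : ℂ) ≠ 0 :=
  ofReal_ne_zero.mpr (height_pos q).ne'

/-- In the coframe `(dq, θ)` the determinant is `(r / h²) (1 / r) = h⁻²`. Passing to `(dp, dq)`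
multiplies it by `(h / 2)²`. -/
theorem chartEH_det {a : ℝ} (ha : 0 < a) (y : ℂ × ℂ) :
    let b : Fin 2 → ℂ × ℂ := ![(1, 0), (0, 1)]
    (Matrix.of fun j k : Fin 2 =>
      ((chartEH a y ![b j, Complex.I • b k] : ℝ) -
        Complex.I * (chartEH a y ![b j, b k] : ℝ)) / 2 : Matrix (Fin 2) (Fin 2) ℂ).det = 1 / 4 := by
  intro b
  have hr := ofReal_rad_ne_zero ha y
  have hh := ofReal_height_ne_zero y.2
  rw [Matrix.det_fin_two]
  simp only [Matrix.of_apply, ofReal_chartEH_apply, theta_I_smul]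
  simp [b, theta_apply]
  field_simp
  simp only [show conj (2 : ℂ) = 2 from Complex.conj_ofNat 2]
  ring_nf
  simp only [I_pow_four]
  ring

/-- In the square of `i (A x ∧ x' + B t ∧ t')` only the cross term survives. The sign `i² = -1`
compensates that of reordering `x ∧ x' ∧ t ∧ t'` into `(t ∧ x) ∧ (t' ∧ x')`. The primed functions,
which will be conjugates, are independent variables here. -/
theorem pfaffian_wedge_bar (x x' t t' : Fin 4 → ℂ) (A B : ℂ) :
    let p : Fin 4 → Fin 4 → ℂ := fun j k =>
      I * (A * (x j * x' k - x k * x' j) + B * (t j * t' k - t k * t' j))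
    let q : Fin 4 → Fin 4 → ℂ := fun j k => t j * x k - t k * x j
    let q' : Fin 4 → Fin 4 → ℂ := fun j k => t' j * x' k - t' k * x' j
    p 0 1 * p 2 3 - p 0 2 * p 1 3 + p 0 3 * p 1 2 =
      A * B * (q 0 1 * q' 2 3 - q 0 2 * q' 1 3 + q 0 3 * q' 1 2 +
        q 1 2 * q' 0 3 - q 1 3 * q' 0 2 + q 2 3 * q' 0 1) := by
  intro p q q'
  simp only [p, q, q']
  linear_combination (-(A * B * ((t 0 * x 1 - t 1 * x 0) * (t' 2 * x' 3 - t' 3 * x' 2)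
    - (t 0 * x 2 - t 2 * x 0) * (t' 1 * x' 3 - t' 3 * x' 1)
    + (t 0 * x 3 - t 3 * x 0) * (t' 1 * x' 2 - t' 2 * x' 1)
    + (t 1 * x 2 - t 2 * x 1) * (t' 0 * x' 3 - t' 3 * x' 0)
    - (t 1 * x 3 - t 3 * x 1) * (t' 0 * x' 2 - t' 2 * x' 0)
    + (t 2 * x 3 - t 3 * x 2) * (t' 0 * x' 1 - t' 1 * x' 0)))) * I_sq

/-- The constant `ε` will be `±1/2`, the coefficient of `Ω` in the two charts. It has to match `h⁻²
(h / 2)² = 1/4`. -/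
theorem chartEH_normalized {a : ℝ} (ha : 0 < a) (y : ℂ × ℂ) (v : Fin 4 → ℂ × ℂ) (ε : ℂ)
    (hε : ε * conj ε = 1 / 4) :
    let p : Fin 4 → Fin 4 → ℂ := fun j k => (chartEH a y ![v j, v k] : ℝ)
    let q : Fin 4 → Fin 4 → ℂ := fun j k => (ε • wedge d1 d2) ![v j, v k]
    2 * (p 0 1 * p 2 3 - p 0 2 * p 1 3 + p 0 3 * p 1 2) =
      2 * (q 0 1 * star (q 2 3) - q 0 2 * star (q 1 3) + q 0 3 * star (q 1 2) +
        q 1 2 * star (q 0 3) - q 1 3 * star (q 0 2) + q 2 3 * star (q 0 1)) := by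
  intro p q
  have hr := ofReal_rad_ne_zero ha y
  have hh := ofReal_height_ne_zero y.2
  have hp : ∀ j k, p j k = I * ((rad a y / height y.2 ^ 2 : ℝ) *
      ((v j).2 * conj (v k).2 - (v k).2 * conj (v j).2) + (1 / rad a y : ℝ) *
      (theta y (v j) * conj (theta y (v k)) - theta y (v k) * conj (theta y (v j)))) :=
    fun j k => ofReal_chartEH_apply a y (v j) (v k)
  have hAB : ((rad a y / height y.2 ^ 2 : ℝ) : ℂ) * (1 / rad a y : ℝ) = (height y.2 : ℂ)⁻¹ ^ 2 := by
    push_cast; field_simp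
  have ht : ∀ j k, theta y (v j) * (v k).2 - theta y (v k) * (v j).2 =
      height y.2 / 2 * ((v j).1 * (v k).2 - (v k).1 * (v j).2) := fun j k => by
    simp only [theta_apply]; push_cast; ring
  have ht' : ∀ j k, conj (theta y (v j)) * conj (v k).2 - conj (theta y (v k)) * conj (v j).2 =
      height y.2 / 2 * star ((v j).1 * (v k).2 - (v k).1 * (v j).2) := fun j k => by
    rw [← map_mul, ← map_mul, ← map_sub, ht]
    rw [map_mul, map_div₀, conj_ofReal, show conj (2 : ℂ) = 2 from Complex.conj_ofNat 2]; rfl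
  have hq : ∀ j k, q j k = ε * ((v j).1 * (v k).2 - (v k).1 * (v j).2) := fun j k => rfl
  have hP := pfaffian_wedge_bar (fun j => (v j).2) (fun j => conj (v j).2)
    (fun j => theta y (v j)) (fun j => conj (theta y (v j))) (rad a y / height y.2 ^ 2 : ℝ)
    (1 / rad a y : ℝ)
  simp only [← hp, hAB, ht, ht'] at hP
  rw [hP]
  simp only [hq, star_mul']
  rw [Complex.star_def] at *
  -- With the values of `dp ∧ dq` as atoms, the two sides are the same expression with different
  -- scalar factors, which `hc` identifies.
  generalize hQ : (fun j k => (v j).1 * (v k).2 - (v k).1 * (v j).2) = Q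
  have hQ' : ∀ j k, (v j).1 * (v k).2 - (v k).1 * (v j).2 = Q j k := fun j k => by rw [← hQ]
  simp only [hQ']
  have hc : (height y.2 : ℂ)⁻¹ ^ 2 * (height y.2 / 2) ^ 2 = ε * conj ε := by
    rw [hε]; field_simp; norm_num
  linear_combination (2 * (Q 0 1 * conj (Q 2 3) - Q 0 2 * conj (Q 1 3) + Q 0 3 * conj (Q 1 2) +
    Q 1 2 * conj (Q 0 3) - Q 1 3 * conj (Q 0 2) + Q 2 3 * conj (Q 0 1))) * hc

/-! ### Smoothness of the form in a chart. -/

theorem contDiff_height : ContDiff ℝ ∞ height :=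
  contDiff_const.add (contDiff_norm_sq ℝ)

/-- Although `|p|` is not smooth at the zero section, its square is, and `a² > 0` keeps the square
root away from zero. -/
theorem contDiff_rad {a : ℝ} (ha : 0 < a) : ContDiff ℝ ∞ (rad a) := by
  have h : rad a = fun y : ℂ × ℂ => √(‖y.1‖ ^ 2 * height y.2 ^ 2 + a ^ 2) := by
    funext y; rw [rad, mul_pow]
  rw [h]
  refine ContDiff.sqrt ?_ fun y => by positivity
  exact ((contDiff_fst.norm_sq ℝ).mul ((contDiff_height.comp contDiff_snd).pow 2)).add
    contDiff_const

/-- In terms of constant two-forms, all dependence on `y` lies in scalar coefficients, which are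
visibly smooth. -/
theorem wedge_theta_bar_theta (y : ℂ × ℂ) : wedge (theta y) (bar (theta y)) =
    ((height y.2 / 2 : ℝ) * (height y.2 / 2 : ℝ) : ℂ) • wedge d1 (bar d1) +
    ((height y.2 / 2 : ℝ) * (conj y.1 * y.2) : ℂ) • wedge d1 (bar d2) +
    ((y.1 * conj y.2) * (height y.2 / 2 : ℝ) : ℂ) • wedge d2 (bar d1) +
    ((y.1 * conj y.2) * (conj y.1 * y.2) : ℂ) • wedge d2 (bar d2) := by
  ext v
  simp only [wedge_apply, bar_apply, theta_apply, ContinuousAlternatingMap.add_apply,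
    ContinuousAlternatingMap.smul_apply, d1_apply, d2_apply, smul_eq_mul, map_add, map_mul,
    conj_ofReal, conj_conj]
  ring

theorem contDiff_chartEH {a : ℝ} (ha : 0 < a) : ContDiff ℝ ∞ (chartEH a) := by
  have hh : ContDiff ℝ ∞ fun y : ℂ × ℂ => height y.2 := contDiff_height.comp contDiff_snd
  have hr := contDiff_rad ha
  have hof : ∀ {f : ℂ × ℂ → ℝ}, ContDiff ℝ ∞ f → ContDiff ℝ ∞ fun y => (f y : ℂ) := fun hf =>
    Complex.ofRealCLM.contDiff.comp hf
  have hc : ∀ {f : ℂ × ℂ → ℂ}, ContDiff ℝ ∞ f → ContDiff ℝ ∞ fun y => conj (f y) := fun hf =>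
    Complex.conjCLE.contDiff.comp hf
  have hp : ContDiff ℝ ∞ fun y : ℂ × ℂ => y.1 := contDiff_fst
  have hq : ContDiff ℝ ∞ fun y : ℂ × ℂ => y.2 := contDiff_snd
  have h2 : ContDiff ℝ ∞ fun y : ℂ × ℂ => height y.2 / 2 := hh.div_const 2
  have hA : ContDiff ℝ ∞ fun y : ℂ × ℂ => rad a y / height y.2 ^ 2 :=
    hr.div (hh.pow 2) fun y => pow_ne_zero 2 (height_pos y.2).ne'
  have hB : ContDiff ℝ ∞ fun y : ℂ × ℂ => 1 / rad a y :=
    contDiff_const.div hr fun y => (rad_pos ha y).ne'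
  have hs : ∀ (f : ℂ × ℂ → ℂ) (η : (ℂ × ℂ) [⋀^Fin 2]→L[ℝ] ℂ), ContDiff ℝ ∞ f →
      ContDiff ℝ ∞ fun y => f y • η := fun f η hf => hf.smul contDiff_const
  have : chartEH a = fun y => ContinuousLinearMap.compContinuousAlternatingMapCLM ℝ (ℂ × ℂ) ℂ ℝ (Fin 2)
      Complex.reCLM
      (Complex.I • (((rad a y / height y.2 ^ 2 : ℝ) : ℂ) • wedge d2 (bar d2) +
      ((1 / rad a y : ℝ) : ℂ) • wedge (theta y) (bar (theta y)))) := by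
    funext y; exact chartEH_eq a y
  rw [this]
  refine (ContinuousLinearMap.contDiff _).comp (ContDiff.const_smul _ (ContDiff.add ?_ ?_))
  · exact hs _ _ (hof hA)
  · refine (hof hB).smul ?_
    simp only [wedge_theta_bar_theta]
    refine ((ContDiff.add ?_ ?_).add ?_).add ?_
    · exact hs _ _ ((hof h2).mul (hof h2))
    · exact hs _ _ ((hof h2).mul ((hc hp).mul hq))
    · exact hs _ _ ((hp.mul (hc hq)).mul (hof h2))
    · exact hs _ _ ((hp.mul (hc hq)).mul ((hc hp).mul hq))

/-! ### Closedness, by differentiation along lines. -/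

theorem hasDerivAt_line {E : Type*} [NormedAddCommGroup E] [NormedSpace ℝ E] (x u : E) :
    HasDerivAt (fun t : ℝ => x + t • u) u 0 := by
  simpa using ((hasDerivAt_id (0 : ℝ)).smul_const u).const_add x

theorem hasDerivAt_norm_sq_line (x u : ℂ) :
    HasDerivAt (fun t : ℝ => ‖x + t • u‖ ^ 2) (x * conj u + u * conj x).re 0 := by
  convert (hasDerivAt_line x u).norm_sq using 1
  simp [Complex.inner]; ring

theorem hasDerivAt_height_line (q u : ℂ) :
    HasDerivAt (fun t : ℝ => height (q + t • u)) (q * conj u + u * conj q).re 0 :=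
  (hasDerivAt_norm_sq_line q u).const_add 1

/-- From `U² = p p̄ h²` one gets `∂(U²) = 2 h p̄ θ`, so that `dr = h (p̄ θ + p θ̄) / r`. That `dr`
is a combination of `θ` and `θ̄` is what makes the form closed. -/
theorem hasDerivAt_rad_line {a : ℝ} (ha : 0 < a) (y u : ℂ × ℂ) :
    HasDerivAt (fun t : ℝ => rad a (y + t • u))
      (height y.2 * (theta y u * conj y.1 + conj (theta y u) * y.1).re / rad a y) 0 := by
  have h1 := ((hasDerivAt_norm_sq_line y.1 u.1).mul
    ((hasDerivAt_height_line y.2 u.2).pow 2)).add_const (a ^ 2)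
  have h2 := h1.sqrt (by simp only [Pi.mul_apply, Pi.pow_apply]; positivity)
  have hr := (rad_pos ha y).ne'
  convert h2 using 1
  · funext t
    simp only [rad, mul_pow]; rfl
  · have e : √((‖y.1 + (0 : ℝ) • u.1‖ ^ 2) * (height (y.2 + (0 : ℝ) • u.2)) ^ 2 + a ^ 2) =
        rad a y := by simp [rad, mul_pow]
    simp only [Pi.mul_apply, Pi.pow_apply]
    rw [e, div_eq_div_iff hr (by positivity)]
    simp only [zero_smul, add_zero]
    rw [Complex.sq_norm, Complex.normSq_apply]
    simp [theta_apply, show conj (2 : ℂ) = 2 from Complex.conj_ofNat 2]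
    ring

theorem ofReal_re_add_conj (x : ℂ) : ((x + conj x).re : ℂ) = x + conj x := by
  apply Complex.ext <;> simp

/-- The derivative of `θ` in the direction `u`. -/
def thetaDeriv (y u v : ℂ × ℂ) : ℂ :=
  (y.2 * conj u.2 + u.2 * conj y.2) / 2 * v.1 + (u.1 * conj y.2 + y.1 * conj u.2) * v.2

theorem hasDerivAt_theta_line (y u v : ℂ × ℂ) :
    HasDerivAt (fun t : ℝ => theta (y + t • u) v) (thetaDeriv y u v) 0 := by
  have hh := (hasDerivAt_height_line y.2 u.2).ofReal_comp
  have hq := (Complex.conjCLE : ℂ →L[ℝ] ℂ).hasFDerivAt.comp_hasDerivAt (0 : ℝ)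
    (hasDerivAt_line y.2 u.2)
  have h := ((hh.div_const 2).mul_const v.1).add
    (((hasDerivAt_line y.1 u.1).mul hq).mul_const v.2)
  refine (h.congr_deriv ?_).congr_of_eventuallyEq (Filter.Eventually.of_forall fun t => ?_)
  rotate_left
  · simp [theta_apply]
  · have e : y.2 * conj u.2 + u.2 * conj y.2 = y.2 * conj u.2 + conj (y.2 * conj u.2) := by
      simp [mul_comm]
    rw [e, ofReal_re_add_conj]
    simp [thetaDeriv, mul_comm]

theorem hasDerivAt_chartEH_line {a : ℝ} (ha : 0 < a) (y u v w : ℂ × ℂ) :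
    HasDerivAt (fun t : ℝ => (chartEH a (y + t • u) ![v, w] : ℂ))
      (I * (((height y.2 * (theta y u * conj y.1 + conj (theta y u) * y.1) / rad a y) /
          height y.2 ^ 2 - 2 * rad a y * (y.2 * conj u.2 + u.2 * conj y.2) / height y.2 ^ 3) *
          (v.2 * conj w.2 - w.2 * conj v.2) +
        (-(height y.2 * (theta y u * conj y.1 + conj (theta y u) * y.1) / rad a y) /
          rad a y ^ 2 * (theta y v * conj (theta y w) - theta y w * conj (theta y v)) +
        1 / rad a y * (thetaDeriv y u v * conj (theta y w) + theta y v * conj (thetaDeriv y u w) -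
          (thetaDeriv y u w * conj (theta y v) + theta y w * conj (thetaDeriv y u v)))))) 0 := by
  have hr := ofReal_rad_ne_zero ha y
  have hh := ofReal_height_ne_zero y.2
  have hh' := (hasDerivAt_height_line y.2 u.2).ofReal_comp
  have hr' := (hasDerivAt_rad_line ha y u).ofReal_comp
  have hconj : ∀ v, HasDerivAt (fun t : ℝ => conj (theta (y + t • u) v)) (conj (thetaDeriv y u v)) 0 :=
    fun v => (Complex.conjCLE : ℂ →L[ℝ] ℂ).hasFDerivAt.comp_hasDerivAt (0 : ℝ)
      (hasDerivAt_theta_line y u v)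
  have hA := (hr'.div (hh'.pow 2) (by simpa using hh)).mul_const (v.2 * conj w.2 - w.2 * conj v.2)
  have hB := (hr'.inv (by simpa using hr)).mul
    (((hasDerivAt_theta_line y u v).mul (hconj w)).sub ((hasDerivAt_theta_line y u w).mul (hconj v)))
  have h := (hA.add hB).const_mul I
  refine (h.congr_deriv ?_).congr_of_eventuallyEq (Filter.Eventually.of_forall fun t => ?_)
  rotate_left
  · simp [ofReal_chartEH_apply]
  · have e : y.2 * conj u.2 + u.2 * conj y.2 = y.2 * conj u.2 + conj (y.2 * conj u.2) := by
      simp [mul_comm]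
    have e' : theta y u * conj y.1 + conj (theta y u) * y.1 =
      theta y u * conj y.1 + conj (theta y u * conj y.1) := by simp
    simp only [e, e', ofReal_mul, ofReal_div, ofReal_re_add_conj, Pi.inv_apply]
    simp only [Pi.pow_apply, Pi.sub_apply, Pi.mul_apply, zero_smul, add_zero,
      Nat.cast_ofNat, Nat.reduceSub, pow_one]
    field_simp

theorem fderiv_chartEH {a : ℝ} (ha : 0 < a) (y u v w : ℂ × ℂ) :
    ((fderiv ℝ (fun x => chartEH a x ![v, w]) y u : ℝ) : ℂ) =
      I * (((height y.2 * (theta y u * conj y.1 + conj (theta y u) * y.1) / rad a y) /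
          height y.2 ^ 2 - 2 * rad a y * (y.2 * conj u.2 + u.2 * conj y.2) / height y.2 ^ 3) *
          (v.2 * conj w.2 - w.2 * conj v.2) +
        (-(height y.2 * (theta y u * conj y.1 + conj (theta y u) * y.1) / rad a y) /
          rad a y ^ 2 * (theta y v * conj (theta y w) - theta y w * conj (theta y v)) +
        1 / rad a y * (thetaDeriv y u v * conj (theta y w) + theta y v * conj (thetaDeriv y u w) -
          (thetaDeriv y u w * conj (theta y v) + theta y w * conj (thetaDeriv y u v))))) := by
  have hd : DifferentiableAt ℝ (chartEH a) (y + (0 : ℝ) • u) :=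
    ((contDiff_chartEH ha).differentiable (by simp)).differentiableAt
  have h1 := ((ContinuousAlternatingMap.apply ℝ (ℂ × ℂ) ℝ ![v, w]).hasFDerivAt.comp _
    hd.hasFDerivAt).differentiableAt.hasFDerivAt
  have h2 := (h1.comp_hasDerivAt (0 : ℝ) (hasDerivAt_line y u)).ofReal_comp
  rw [zero_smul, add_zero] at h2
  exact h2.unique (hasDerivAt_chartEH_line ha y u v w)

/-- `dh ∧ dq ∧ dq̄` vanishes since `dh` involves only `dq` and `dq̄`, and `dr ∧ θ ∧ θ̄` since `dr`
involves only `θ` and `θ̄`. The remaining terms `h⁻² dr ∧ dq ∧ dq̄` and `r⁻¹ d(θ ∧ θ̄)` cancel. -/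
theorem extDeriv_chartEH {a : ℝ} (ha : 0 < a) (y : ℂ × ℂ) : extDeriv (chartEH a) y = 0 := by
  ext m
  have hr := ofReal_rad_ne_zero ha y
  have hh := ofReal_height_ne_zero y.2
  rw [extDeriv_apply ((contDiff_chartEH ha).differentiable (by simp)).differentiableAt, Fin.sum_univ_three]
  have e0 : Fin.removeNth 0 m = ![m 1, m 2] := by ext i : 1; fin_cases i <;> rfl
  have e1 : Fin.removeNth 1 m = ![m 0, m 2] := by ext i : 1; fin_cases i <;> rfl
  have e2 : Fin.removeNth 2 m = ![m 0, m 1] := by ext i : 1; fin_cases i <;> rfl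
  rw [e0, e1, e2, ← Complex.ofReal_inj]
  generalize m 0 = u
  generalize m 1 = v
  generalize m 2 = w
  simp only [Fin.val_zero, Fin.val_one, Fin.val_two, pow_zero, pow_one, one_smul, neg_smul,
    even_two.neg_pow, one_pow, ofReal_add, ofReal_neg, fderiv_chartEH ha]
  change _ = ((0 : ℝ) : ℂ)
  simp only [thetaDeriv, theta_apply, map_add, map_mul, map_div₀, conj_conj,
    show conj (2 : ℂ) = 2 from Complex.conj_ofNat 2, conj_ofReal]
  field_simp
  push_cast
  -- Only `h = 1 + q q̄` has to be inserted. The value of `r` is not needed, because the terms that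
  -- do not vanish separately all carry the factor `1 / r`.
  rw [ofReal_height]
  ring

/-! ### Comparison with the form on `ℂ² \ {0}`. -/

/-- The derivative of `(z₁, z₂) ↦ (z₁², z₂ / z₁)`. -/
def squareDeriv (z v : ℂ × ℂ) : ℂ × ℂ :=
  (2 * z.1 * v.1, (z.1 * v.2 - z.2 * v.1) / z.1 ^ 2)

/-- The Jacobian determinant is `2 z₁ · z₁⁻¹ = 2`, which explains the factor `½` in `Ω`. -/
theorem wedge_squareDeriv {z : ℂ × ℂ} (hz : z.1 ≠ 0) (v w : ℂ × ℂ) :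
    ((1 / 2 : ℂ) • wedge d1 d2) ![squareDeriv z v, squareDeriv z w] = wedge d1 d2 ![v, w] := by
  simp [squareDeriv]
  field_simp
  ring

theorem ofReal_U (z : ℂ × ℂ) : (U z : ℂ) = z.1 * conj z.1 + z.2 * conj z.2 := by
  rw [U, Complex.mul_conj', Complex.mul_conj']; push_cast; rfl

theorem U_pos {z : ℂ × ℂ} (hz : z ≠ 0) : 0 < U z := by
  rcases eq_or_ne z.1 0 with h | h
  · have h2 : 0 < ‖z.2‖ := norm_pos_iff.mpr fun h2 => hz (Prod.ext h h2)
    unfold U; positivity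
  · have h1 : 0 < ‖z.1‖ := norm_pos_iff.mpr h
    unfold U; positivity

theorem height_div {z : ℂ × ℂ} (hz : z.1 ≠ 0) : height (z.2 / z.1) = U z / ‖z.1‖ ^ 2 := by
  have : ‖z.1‖ ≠ 0 := norm_ne_zero_iff.mpr hz
  rw [height, U, norm_div]; field_simp

theorem rad_square (a : ℝ) {z : ℂ × ℂ} (hz : z.1 ≠ 0) :
    rad a (z.1 ^ 2, z.2 / z.1) = √(U z ^ 2 + a ^ 2) := by
  have : ‖z.1‖ ≠ 0 := norm_ne_zero_iff.mpr hz
  have : ‖z.1 ^ 2‖ * height (z.2 / z.1) = U z := by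
    rw [height_div hz, norm_pow]; field_simp
  simp only [rad, this]

theorem delU_apply (z v : ℂ × ℂ) : delU z v = conj z.1 * v.1 + conj z.2 * v.2 := rfl

theorem theta_square {z : ℂ × ℂ} (hz : z.1 ≠ 0) (v : ℂ × ℂ) :
    theta (z.1 ^ 2, z.2 / z.1) (squareDeriv z v) = z.1 / conj z.1 * delU z v := by
  have hz' : conj z.1 ≠ 0 := by simpa using hz
  simp only [theta_apply, squareDeriv, ofReal_div, ofReal_height, map_div₀, delU_apply]
  push_cast
  field_simp
  ring

theorem flatEH_apply (a : ℝ) (z v w : ℂ × ℂ) : flatEH a z ![v, w] =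
    I / ((U z ^ 2 * √(U z ^ 2 + a ^ 2) : ℝ) : ℂ) *
      (((U z ^ 2 + a ^ 2) * U z : ℝ) *
        (v.1 * conj w.1 - w.1 * conj v.1 + (v.2 * conj w.2 - w.2 * conj v.2)) -
      ((a ^ 2 : ℝ) : ℂ) * (delU z v * conj (delU z w) - delU z w * conj (delU z v))) := rfl

theorem flatEH_swap (a : ℝ) (z v w : ℂ × ℂ) :
    flatEH a z.swap ![v.swap, w.swap] = flatEH a z ![v, w] := by
  have h1 : U z.swap = U z := add_comm _ _
  have h2 : ∀ v : ℂ × ℂ, delU z.swap v.swap = delU z v := fun v => add_comm _ _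
  simp only [flatEH_apply, h1, h2, Prod.fst_swap, Prod.snd_swap]
  ring

/-- Here `dq = (z₁ dz₂ - z₂ dz₁) / z₁²`, and `θ` is `∂U` up to a phase. The two expressions then
agree by the Lagrange identity `key` below. -/
theorem chartEH_square {a : ℝ} (ha : 0 < a) {z : ℂ × ℂ} (hz : z.1 ≠ 0) (v w : ℂ × ℂ) :
    (chartEH a (z.1 ^ 2, z.2 / z.1) ![squareDeriv z v, squareDeriv z w] : ℂ) =
      flatEH a z ![v, w] := by
  have hz' : conj z.1 ≠ 0 := by simpa using hz
  have hU := U_pos (z := z) fun h => hz (by rw [h]; rfl)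
  have hU' : (U z : ℂ) ≠ 0 := ofReal_ne_zero.mpr hU.ne'
  have hs : 0 < √(U z ^ 2 + a ^ 2) := by positivity
  have hs2 : √(U z ^ 2 + a ^ 2) ^ 2 = U z ^ 2 + a ^ 2 := Real.sq_sqrt (by positivity)
  rw [ofReal_chartEH_apply, theta_square hz, theta_square hz, rad_square a hz, height_div hz,
    flatEH_apply]
  generalize √(U z ^ 2 + a ^ 2) = s at hs hs2 ⊢
  have hs' : (s : ℂ) ≠ 0 := ofReal_ne_zero.mpr hs.ne'
  have hs2' : (s : ℂ) ^ 2 = (U z : ℂ) ^ 2 + (a : ℂ) ^ 2 := by exact_mod_cast hs2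
  have hn : (‖z.1‖ : ℂ) ^ 2 = z.1 * conj z.1 := (Complex.mul_conj' _).symm
  push_cast
  rw [hn, ← hs2']
  -- Eliminating `a²` leaves a rational identity in `s` and `U`.
  have ha2 : (a : ℂ) ^ 2 = s ^ 2 - U z ^ 2 := by rw [hs2']; ring
  rw [ha2]
  -- Lagrange's identity `U ∂∂̄U - ∂U ∧ ∂̄U = α ∧ ᾱ` with `α = z₁ dz₂ - z₂ dz₁`.
  have key : U z * (v.1 * conj w.1 - w.1 * conj v.1 + (v.2 * conj w.2 - w.2 * conj v.2)) -
      (delU z v * conj (delU z w) - delU z w * conj (delU z v)) =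
      (z.1 * v.2 - z.2 * v.1) * conj (z.1 * w.2 - z.2 * w.1) -
        (z.1 * w.2 - z.2 * w.1) * conj (z.1 * v.2 - z.2 * v.1) := by
    simp only [ofReal_U, delU_apply, map_add, map_sub, map_mul, conj_conj]
    ring
  simp only [squareDeriv, map_div₀, map_mul, map_pow, conj_conj]
  generalize z.1 * v.2 - z.2 * v.1 = X at key ⊢
  generalize z.1 * w.2 - z.2 * w.1 = Y at key ⊢
  generalize delU z v = P at key ⊢
  generalize delU z w = Q at key ⊢
  field_simp
  linear_combination (-(s : ℂ) ^ 2) * key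

/-! ### Two-forms given in the two charts, and their pull-backs. -/

theorem chartAt_of_mem {x : KCP1} (h : x ∈ chart0.source) : chartAt (ℂ × ℂ) x = chart0 :=
  if_pos h

theorem chartAt_of_notMem {x : KCP1} (h : x ∉ chart0.source) : chartAt (ℂ × ℂ) x = chart1 :=
  if_neg h

/-- The tangent space at `x` is trivialized by the preferred chart at `x`. Hence the differentials
in `ofCharts` are identities, and its value at `x` is just the chart expression. -/
theorem mfderiv_chartAt (x : KCP1) :
    mfderiv 𝓘(ℝ, ℂ × ℂ) 𝓘(ℝ, ℂ × ℂ) (chartAt (ℂ × ℂ) x) x = ContinuousLinearMap.id ℝ (ℂ × ℂ) := by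
  have := mfderiv_extChartAt_self (I := 𝓘(ℝ, ℂ × ℂ)) (x := x)
  simpa using! this

section ofCharts

variable {F : Type} [AddCommGroup F] [Module ℝ F] [TopologicalSpace F]
  (η₀ η₁ : ℂ × ℂ → (ℂ × ℂ) [⋀^Fin 2]→L[ℝ] F)

theorem ofCharts_apply_of_mem {x : KCP1} (h : x ∈ chart0.source) (v : Fin 2 → ℂ × ℂ) :
    ofCharts η₀ η₁ x v = η₀ (chart0 x) v := by
  have h1 := mfderiv_chartAt x
  rw [chartAt_of_mem h] at h1
  rw [ofCharts, if_pos h, h1]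
  rfl

theorem ofCharts_apply_of_notMem {x : KCP1} (h : x ∉ chart0.source) (v : Fin 2 → ℂ × ℂ) :
    ofCharts η₀ η₁ x v = η₁ (chart1 x) v := by
  have h1 := mfderiv_chartAt x
  rw [chartAt_of_notMem h] at h1
  rw [ofCharts, if_neg h, h1]
  rfl

theorem chart0_mem_atlas : chart0 ∈ atlas (ℂ × ℂ) KCP1 := Or.inl rfl

theorem chart1_mem_atlas : chart1 ∈ atlas (ℂ × ℂ) KCP1 := Or.inr rfl

theorem chart1_target : chart1.target = Set.univ := by
  simp [chart1, chart0]

variable {E H M : Type} [NormedAddCommGroup E] [NormedSpace ℝ E] [TopologicalSpace H]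
  {I : ModelWithCorners ℝ E H} [TopologicalSpace M] [ChartedSpace H M]

theorem pullback_apply (f : M → KCP1) (η : TwoForm F) (y : M) (v w : TangentSpace I y) :
    pullback I f η y ![v, w] =
      η (f y) ![mfderiv I 𝓘(ℝ, ℂ × ℂ) f y v, mfderiv I 𝓘(ℝ, ℂ × ℂ) f y w] := by
  change η (f y) _ = η (f y) _
  congr 1
  ext i : 1
  fin_cases i <;> rfl

theorem mdifferentiableAt_of_eventuallyEq_symm {e : OpenPartialHomeomorph KCP1 (ℂ × ℂ)}
    (he : e ∈ atlas (ℂ × ℂ) KCP1) {f : M → KCP1} {y : M} {G : M → ℂ × ℂ}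
    (hG : MDifferentiableAt I 𝓘(ℝ, ℂ × ℂ) G y) (hy : G y ∈ e.target)
    (hf : f =ᶠ[𝓝 y] e.symm ∘ G) : MDifferentiableAt I 𝓘(ℝ, ℂ × ℂ) f y := by
  have h := mdifferentiableAt_atlas_symm (I := 𝓘(ℝ, ℂ × ℂ)) he hy
  exact (h.comp y hG).congr_of_eventuallyEq hf

/-- In a chart `e` near `f y`, the differential of `f` is that of the coordinate expression of
`f`. -/
theorem mfderiv_chart_comp {e : OpenPartialHomeomorph KCP1 (ℂ × ℂ)}
    (he : e ∈ atlas (ℂ × ℂ) KCP1) {f : M → KCP1} {y : M} {G : M → ℂ × ℂ}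
    {D : TangentSpace I y →L[ℝ] ℂ × ℂ}
    (hG : HasMFDerivAt I 𝓘(ℝ, ℂ × ℂ) G y D) (hy : ∀ z, G z ∈ e.target)
    (hf : f =ᶠ[𝓝 y] e.symm ∘ G) (v : TangentSpace I y) :
    mfderiv 𝓘(ℝ, ℂ × ℂ) 𝓘(ℝ, ℂ × ℂ) e (f y) (mfderiv I 𝓘(ℝ, ℂ × ℂ) f y v) = D v := by
  have hfd := mdifferentiableAt_of_eventuallyEq_symm he hG.mdifferentiableAt (hy y) hf
  have hs : f y ∈ e.source := by
    rw [hf.eq_of_nhds]; exact e.map_target (hy y)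
  have hed := mdifferentiableAt_atlas (I := 𝓘(ℝ, ℂ × ℂ)) he hs
  have h1 := (hed.hasMFDerivAt.comp y hfd.hasMFDerivAt)
  have h2 : e ∘ f =ᶠ[𝓝 y] G := hf.mono fun z hz => by
    rw [Function.comp_apply, hz]; exact e.right_inv (hy z)
  have h3 := hasMFDerivAt_unique h1 (hG.congr_of_eventuallyEq h2)
  exact DFunLike.congr_fun h3 v

/-- `chart0` is the preferred chart wherever it is defined, so the differential of `f` is that of
its coordinate expression `G`. -/
theorem pullback_ofCharts_of_eq_chart0_symm {f : M → KCP1} {y : M} {G : M → ℂ × ℂ}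
    {D : TangentSpace I y →L[ℝ] ℂ × ℂ} (hG : HasMFDerivAt I 𝓘(ℝ, ℂ × ℂ) G y D)
    (hf : f =ᶠ[𝓝 y] chart0.symm ∘ G) (v w : TangentSpace I y) :
    pullback I f (ofCharts η₀ η₁) y ![v, w] = η₀ (G y) ![D v, D w] := by
  have hs : f y ∈ chart0.source := by
    rw [hf.eq_of_nhds]; exact chart0.map_target (Set.mem_univ _)
  have hc : chart0 (f y) = G y := by
    rw [hf.eq_of_nhds]; exact chart0.right_inv (Set.mem_univ _)
  have hm := mfderiv_chart_comp chart0_mem_atlas hG (fun z => Set.mem_univ _) hf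
  have h1 := mfderiv_chartAt (f y)
  rw [chartAt_of_mem hs] at h1
  simp only [h1] at hm
  rw [pullback_apply, ← hm v, ← hm w, ← hc]
  exact ofCharts_apply_of_mem η₀ η₁ hs _

theorem exists_hasFDerivAt_transition {y : ℂ × ℂ} (hq : y.2 ≠ 0) :
    ∃ T : ℂ × ℂ →L[ℝ] ℂ × ℂ,
      HasFDerivAt (fun y : ℂ × ℂ => ((y.1 * y.2 ^ 2, y.2⁻¹) : ℂ × ℂ)) T y ∧
      ∀ v, T v = transitionDeriv y v := by
  have h1 : HasFDerivAt (𝕜 := ℂ) (fun y : ℂ × ℂ => y.1) _ y := hasFDerivAt_fst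
  have h2 : HasFDerivAt (𝕜 := ℂ) (fun y : ℂ × ℂ => y.2) _ y := hasFDerivAt_snd
  have h := ((h1.mul (h2.pow 2)).prodMk ((hasDerivAt_inv hq).comp_hasFDerivAt y h2))
  refine ⟨_, h.restrictScalars ℝ, fun v => ?_⟩
  ext <;> simp [transitionDeriv] <;> ring

theorem exists_hasFDerivAt_square {z : ℂ × ℂ} (hz : z.1 ≠ 0) :
    ∃ T : ℂ × ℂ →L[ℝ] ℂ × ℂ,
      HasFDerivAt (fun z : ℂ × ℂ => ((z.1 ^ 2, z.2 / z.1) : ℂ × ℂ)) T z ∧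
      ∀ v, T v = squareDeriv z v := by
  have h1 : HasFDerivAt (𝕜 := ℂ) (fun y : ℂ × ℂ => y.1) _ z := hasFDerivAt_fst
  have h2 : HasFDerivAt (𝕜 := ℂ) (fun y : ℂ × ℂ => y.2) _ z := hasFDerivAt_snd
  have h := (h1.pow 2).prodMk (h2.mul ((hasDerivAt_inv hz).comp_hasFDerivAt z h1))
  refine ⟨_, h.restrictScalars ℝ, fun v => ?_⟩
  ext <;> simp [squareDeriv]
  field_simp
  ring

/-- `η₀` in `chart0` and `η₁` in `chart1` agree on the overlap. -/
def Compatible : Prop := ∀ y : ℂ × ℂ, y.2 ≠ 0 → ∀ v w,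
  η₀ (y.1 * y.2 ^ 2, y.2⁻¹) ![transitionDeriv y v, transitionDeriv y w] = η₁ y ![v, w]

variable {η₀ η₁}

/-- On the overlap the tangent space is trivialized by `chart0`, so `G` is composed with the
coordinate change and compatibility is used. Off `dom0` the preferred chart is `chart1` itself. -/
theorem pullback_ofCharts_of_eq_chart1_symm (hη : Compatible η₀ η₁)
    {f : M → KCP1} {y : M} {G : M → ℂ × ℂ}
    {D : TangentSpace I y →L[ℝ] ℂ × ℂ} (hG : HasMFDerivAt I 𝓘(ℝ, ℂ × ℂ) G y D)
    (hf : f =ᶠ[𝓝 y] chart1.symm ∘ G) (v w : TangentSpace I y) :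
    pullback I f (ofCharts η₀ η₁) y ![v, w] = η₁ (G y) ![D v, D w] := by
  have ht : ∀ z, z ∈ chart1.target := fun z => by rw [chart1_target]; trivial
  by_cases hs : f y ∈ chart0.source
  · have hq : (G y).2 ≠ 0 := by
      apply transition_source.2
      rw [hf.eq_of_nhds] at hs
      exact ⟨ht _, hs⟩
    obtain ⟨T, hT, hTv⟩ := exists_hasFDerivAt_transition hq
    have hG' := hT.hasMFDerivAt.comp y hG
    have hf' : f =ᶠ[𝓝 y] chart0.symm ∘
        ((fun y : ℂ × ℂ => ((y.1 * y.2 ^ 2, y.2⁻¹) : ℂ × ℂ)) ∘ G) := by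
      have hne : ∀ᶠ z in 𝓝 y, (G z).2 ≠ 0 :=
        (continuous_snd.continuousAt.comp hG.continuousAt).eventually_ne hq
      filter_upwards [hf, hne] with z hz hz2
      rw [hz, Function.comp_apply, Function.comp_apply, Function.comp_apply,
        ← (transition (G z)).2, chart0.left_inv]
      change mk (⟨((G z).2, 1), by simp⟩, (G z).1) ∈ dom0
      exact (mk_mem_dom0 _).mpr hz2
    rw [pullback_ofCharts_of_eq_chart0_symm η₀ η₁ hG' hf']
    have e : ∀ v, (T.comp D) v = transitionDeriv (G y) (D v) := fun v => hTv _
    erw [e, e]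
    exact hη _ hq _ _
  · have hc : chart1 (f y) = G y := by
      rw [hf.eq_of_nhds]; exact chart1.right_inv (ht _)
    have hm := mfderiv_chart_comp chart1_mem_atlas hG (fun z => ht _) hf
    have h1 := mfderiv_chartAt (f y)
    rw [chartAt_of_notMem hs] at h1
    simp only [h1] at hm
    rw [pullback_apply, ← hm v, ← hm w, ← hc]
    exact ofCharts_apply_of_notMem η₀ η₁ hs _

theorem inChart_ofCharts_chart0 (y : ℂ × ℂ) : inChart (ofCharts η₀ η₁) chart0 y = η₀ y := by
  ext v
  have : v = ![v 0, v 1] := by ext i : 1; fin_cases i <;> rfl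
  rw [this]
  exact pullback_ofCharts_of_eq_chart0_symm η₀ η₁ (hasMFDerivAt_id (I := 𝓘(ℝ, ℂ × ℂ)) y)
    (Filter.EventuallyEq.refl _ _) (v 0) (v 1)

theorem inChart_ofCharts_chart1 (hη : Compatible η₀ η₁) (y : ℂ × ℂ) :
    inChart (ofCharts η₀ η₁) chart1 y = η₁ y := by
  ext v
  have : v = ![v 0, v 1] := by ext i : 1; fin_cases i <;> rfl
  rw [this]
  exact pullback_ofCharts_of_eq_chart1_symm hη (hasMFDerivAt_id (I := 𝓘(ℝ, ℂ × ℂ)) y)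
    (Filter.EventuallyEq.refl _ _) (v 0) (v 1)

variable {E : Type} [NormedAddCommGroup E] [NormedSpace ℝ E] {f : E → KCP1} {y : E}
  {G : E → ℂ × ℂ} {D : E →L[ℝ] ℂ × ℂ} {D' : E → ℂ × ℂ}

theorem pullback_ofCharts_of_hasFDerivAt_chart0 (hG : HasFDerivAt G D y) (hD : ∀ v, D v = D' v)
    (hf : f =ᶠ[𝓝 y] chart0.symm ∘ G) (v w : E) :
    pullback 𝓘(ℝ, E) f (ofCharts η₀ η₁) y ![v, w] = η₀ (G y) ![D' v, D' w] := by
  rw [← hD, ← hD]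
  exact pullback_ofCharts_of_eq_chart0_symm η₀ η₁ hG.hasMFDerivAt hf v w

theorem pullback_ofCharts_of_hasFDerivAt_chart1 (hη : Compatible η₀ η₁) (hG : HasFDerivAt G D y)
    (hD : ∀ v, D v = D' v) (hf : f =ᶠ[𝓝 y] chart1.symm ∘ G) (v w : E) :
    pullback 𝓘(ℝ, E) f (ofCharts η₀ η₁) y ![v, w] = η₁ (G y) ![D' v, D' w] := by
  rw [← hD, ← hD]
  exact pullback_ofCharts_of_eq_chart1_symm hη hG.hasMFDerivAt hf v w

end ofCharts

/-! ### The global forms `ω` and `Ω`. -/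

theorem compatible_chartEH (a : ℝ) : Compatible (chartEH a) (chartEH a) :=
  fun _ hq v w => chartEH_transition a hq v w

theorem compatible_wedge : Compatible (fun _ => (1 / 2 : ℂ) • wedge d1 d2)
    (fun _ => (-1 / 2 : ℂ) • wedge d1 d2) := fun y hq v w => by
  rw [ContinuousAlternatingMap.smul_apply, wedge_transition hq,
    ContinuousAlternatingMap.smul_apply, smul_neg, ← neg_smul, neg_div]

theorem inChart_omega (a : ℝ) {e : OpenPartialHomeomorph KCP1 (ℂ × ℂ)}
    (he : e ∈ atlas (ℂ × ℂ) KCP1) : inChart (omega a) e = chartEH a := by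
  funext y
  rcases he with rfl | rfl
  · exact inChart_ofCharts_chart0 y
  · exact inChart_ofCharts_chart1 (compatible_chartEH a) y

theorem exists_omega_apply (a : ℝ) (x : KCP1) :
    ∃ y, ∀ v : Fin 2 → ℂ × ℂ, omega a x v = chartEH a y v := by
  by_cases h : x ∈ chart0.source
  · exact ⟨_, ofCharts_apply_of_mem _ _ h⟩
  · exact ⟨_, ofCharts_apply_of_notMem _ _ h⟩

theorem isKaehlerForm_omega {a : ℝ} (ha : 0 < a) : IsKaehlerForm (omega a) where
  smooth e he := by rw [inChart_omega a he]; exact (contDiff_chartEH ha).contDiffOn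
  closed e he y _ := by rw [inChart_omega a he]; exact extDeriv_chartEH ha y
  map_J x v w := by
    obtain ⟨y, hy⟩ := exists_omega_apply a x
    exact (hy _).trans ((chartEH_I_smul a y v w).trans (hy _).symm)
  pos x v hv := by
    obtain ⟨y, hy⟩ := exists_omega_apply a x
    exact (chartEH_pos ha y hv).trans_eq (hy _).symm

theorem isRicciFlat_omega {a : ℝ} (ha : 0 < a) : IsRicciFlat (omega a) := by
  intro e he y _ v w
  have : (fun y' => Real.log (hermMatrix (omega a) e y').det.re) =
      fun _ => Real.log (1 / 4 : ℂ).re := by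
    funext y'
    rw [← chartEH_det ha y', hermMatrix, inChart_omega a he]
  rw [ricciForm, this, ddbar]
  simp [fderiv_fun_const]

theorem isHolomorphicVolumeForm_Omega : IsHolomorphicVolumeForm Omega := by
  rintro e (rfl | rfl)
  · exact ⟨fun _ => 1 / 2, differentiableOn_const _, fun y _ => ⟨by norm_num,
      inChart_ofCharts_chart0 y⟩⟩
  · exact ⟨fun _ => -1 / 2, differentiableOn_const _, fun y _ => ⟨by norm_num,
      inChart_ofCharts_chart1 compatible_wedge y⟩⟩

theorem isNormalized_omega_Omega {a : ℝ} (ha : 0 < a) : IsNormalized (omega a) Omega := by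
  intro x v
  by_cases h : x ∈ chart0.source
  · have h1 := ofCharts_apply_of_mem (chartEH a) (chartEH a) h
    have h2 := ofCharts_apply_of_mem (fun _ => (1 / 2 : ℂ) • wedge d1 d2)
      (fun _ => (-1 / 2 : ℂ) • wedge d1 d2) h
    have := chartEH_normalized ha (chart0 x) v (1 / 2) (by
      rw [map_div₀, map_one, show conj (2 : ℂ) = 2 from Complex.conj_ofNat 2]; norm_num)
    simp only [← h1, ← h2] at this
    exact this
  · have h1 := ofCharts_apply_of_notMem (chartEH a) (chartEH a) h
    have h2 := ofCharts_apply_of_notMem (fun _ => (1 / 2 : ℂ) • wedge d1 d2)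
      (fun _ => (-1 / 2 : ℂ) • wedge d1 d2) h
    have := chartEH_normalized ha (chart1 x) v (-1 / 2) (by
      rw [map_div₀, map_neg, map_one, show conj (2 : ℂ) = 2 from Complex.conj_ofNat 2]; norm_num)
    simp only [← h1, ← h2] at this
    exact this

theorem liftPoint_of_fst_ne_zero {z : ℂ × ℂ} (hz : z.1 ≠ 0) :
    liftPoint z = chart0.symm (z.1 ^ 2, z.2 / z.1) := by
  have h0 : z ≠ 0 := fun h => hz (by rw [h]; rfl)
  rw [liftPoint, dif_neg h0]
  refine (mk_eq_mk.mpr ⟨z.1⁻¹, inv_ne_zero hz, ?_, ?_⟩ : _ = mk (⟨(1, z.2 / z.1), by simp⟩, z.1 ^ 2))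
  · ext
    · simp [hz]
    · simp; ring
  · simp; field_simp

theorem liftPoint_of_snd_ne_zero {z : ℂ × ℂ} (hz : z.2 ≠ 0) :
    liftPoint z = chart1.symm (z.2 ^ 2, z.1 / z.2) := by
  have h0 : z ≠ 0 := fun h => hz (by rw [h]; rfl)
  rw [liftPoint, dif_neg h0]
  refine (mk_eq_mk.mpr ⟨z.2⁻¹, inv_ne_zero hz, ?_, ?_⟩ : _ = mk (⟨(z.1 / z.2, 1), by simp⟩, z.2 ^ 2))
  · ext
    · simp; ring
    · simp [hz]
  · simp; field_simp

theorem exists_hasFDerivAt_square_swap {z : ℂ × ℂ} (hz : z.2 ≠ 0) :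
    ∃ T : ℂ × ℂ →L[ℝ] ℂ × ℂ,
      HasFDerivAt (fun z : ℂ × ℂ => ((z.2 ^ 2, z.1 / z.2) : ℂ × ℂ)) T z ∧
      ∀ v, T v = squareDeriv z.swap v.swap := by
  obtain ⟨T, hT, hTv⟩ := exists_hasFDerivAt_square (z := z.swap) hz
  exact ⟨T.comp (ContinuousLinearEquiv.prodComm ℝ ℂ ℂ : ℂ × ℂ →L[ℝ] ℂ × ℂ),
    hT.comp z (ContinuousLinearEquiv.prodComm ℝ ℂ ℂ).hasFDerivAt, fun v => hTv _⟩

/-- At points with `z₁ = 0` the second chart is used, with `z₁` and `z₂` exchanged. The exchange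
reverses `dz₁ ∧ dz₂`, which cancels the sign of `-½`. -/
theorem pullback_liftPoint {a : ℝ} (ha : 0 < a) {z : ℂ × ℂ} (hz : z ≠ 0) (v w : ℂ × ℂ) :
    ((pullback 𝓘(ℝ, ℂ × ℂ) liftPoint (omega a) z ![v, w] : ℝ) : ℂ) = flatEH a z ![v, w] ∧
      pullback 𝓘(ℝ, ℂ × ℂ) liftPoint Omega z ![v, w] = wedge d1 d2 ![v, w] := by
  rcases eq_or_ne z.1 0 with h1 | h1
  · have h2 : z.2 ≠ 0 := fun h2 => hz (Prod.ext h1 h2)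
    obtain ⟨T, hT, hTv⟩ := exists_hasFDerivAt_square_swap h2
    have hf : liftPoint =ᶠ[𝓝 z] chart1.symm ∘
        fun z : ℂ × ℂ => ((z.2 ^ 2, z.1 / z.2) : ℂ × ℂ) :=
      (continuous_snd.continuousAt.eventually_ne h2).mono fun z hz => liftPoint_of_snd_ne_zero hz
    have e1 := pullback_ofCharts_of_hasFDerivAt_chart1 (compatible_chartEH a) hT hTv hf v w
    have e2 := pullback_ofCharts_of_hasFDerivAt_chart1 compatible_wedge hT hTv hf v w
    have e3 := chartEH_square (z := z.swap) ha h2 v.swap w.swap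
    have e4 := wedge_squareDeriv (z := z.swap) h2 v.swap w.swap
    rw [ContinuousAlternatingMap.smul_apply] at e2 e4
    simp only [Prod.fst_swap, Prod.snd_swap] at e3
    rw [omega, Omega, e1, e2, e3, flatEH_swap]
    refine ⟨rfl, ?_⟩
    rw [neg_div, neg_smul, e4]
    simp
    ring
  · obtain ⟨T, hT, hTv⟩ := exists_hasFDerivAt_square h1
    have hf : liftPoint =ᶠ[𝓝 z] chart0.symm ∘
        fun z : ℂ × ℂ => ((z.1 ^ 2, z.2 / z.1) : ℂ × ℂ) :=
      (continuous_fst.continuousAt.eventually_ne h1).mono fun z hz => liftPoint_of_fst_ne_zero hz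
    have e1 := pullback_ofCharts_of_hasFDerivAt_chart0 (η₀ := chartEH a) (η₁ := chartEH a)
      hT hTv hf v w
    have e2 := pullback_ofCharts_of_hasFDerivAt_chart0 (η₀ := fun _ => (1 / 2 : ℂ) • wedge d1 d2)
      (η₁ := fun _ => (-1 / 2 : ℂ) • wedge d1 d2) hT hTv hf v w
    rw [omega, Omega, e1, e2]
    exact ⟨chartEH_square ha h1 v w, wedge_squareDeriv h1 v w⟩

/-! ### The blow-down map. -/

theorem toOrbifold_eq {z w : ℂ × ℂ} : toOrbifold z = toOrbifold w ↔ w = z ∨ w = -z :=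
  ⟨fun h => Quotient.exact (s := signSetoid) h, fun h => Quotient.sound (s := signSetoid) h⟩

theorem toOrbifold_neg (z : ℂ × ℂ) : toOrbifold (-z) = toOrbifold z :=
  toOrbifold_eq.mpr (Or.inr (neg_neg z).symm)

theorem exists_mk (x : KCP1) : ∃ (z : {z : ℂ × ℂ // z ≠ 0}) (t : ℂ), x = mk (z, t) := by
  induction x using Quotient.inductionOn with
  | h y => exact ⟨y.1, y.2, rfl⟩

theorem mk_smul {z : {z : ℂ × ℂ // z ≠ 0}} {l t : ℂ} (hl : l ≠ 0) :
    mk (z, l ^ 2 * t) = mk (⟨l • z.1, smul_ne_zero hl z.2⟩, t) :=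
  mk_eq_mk.mpr ⟨l, hl, rfl, rfl⟩

/-- `blowDown` is defined with the principal square root, but any root `r` will do, since the sign
is lost in `ℂ² / ℤ₂`. -/
theorem blowDown_mk (z : {z : ℂ × ℂ // z ≠ 0}) (r : ℂ) :
    blowDown (mk (z, r ^ 2)) = toOrbifold (r • z.1) := by
  have hs : ((r ^ 2) ^ (1 / 2 : ℂ)) ^ 2 = r ^ 2 := by
    have h := Complex.cpow_nat_inv_pow (r ^ 2) (n := 2) two_ne_zero
    rwa [Nat.cast_ofNat, ← one_div] at h
  change toOrbifold (((r ^ 2) ^ (1 / 2 : ℂ)) • z.1) = _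
  rcases sq_eq_sq_iff_eq_or_eq_neg.mp hs with h | h
  · rw [h]
  · rw [h, neg_smul, toOrbifold_neg]

theorem blowDown_mk_one (z : {z : ℂ × ℂ // z ≠ 0}) : blowDown (mk (z, 1)) = toOrbifold z.1 := by
  simpa using blowDown_mk z 1

/-- Injectivity away from `E`: `[z', r²] = [r z', 1]`, and both signs of `r z'` give the same point.
-/
theorem eq_mk_of_blowDown_eq {x : KCP1} {z : {z : ℂ × ℂ // z ≠ 0}}
    (h : blowDown x = toOrbifold z.1) : x = mk (z, 1) := by
  obtain ⟨z', t, rfl⟩ := exists_mk x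
  obtain ⟨r, rfl⟩ := IsAlgClosed.exists_pow_nat_eq t two_pos
  rw [blowDown_mk, toOrbifold_eq] at h
  have hr : r ≠ 0 := by
    rintro rfl
    exact z.2 (by simpa using h)
  rcases h with h | h
  · exact mk_eq_mk.mpr ⟨r, hr, h, by simp⟩
  · exact mk_eq_mk.mpr ⟨-r, neg_ne_zero.mpr hr, by rw [neg_smul]; exact h, by simp⟩

theorem preimage_blowDown_zero : blowDown ⁻¹' {toOrbifold 0} = exceptional := by
  ext x
  obtain ⟨z, t, rfl⟩ := exists_mk x
  obtain ⟨r, rfl⟩ := IsAlgClosed.exists_pow_nat_eq t two_pos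
  rw [Set.mem_preimage, Set.mem_singleton_iff, blowDown_mk, toOrbifold_eq]
  constructor
  · intro h
    have h0 : r • z.1 = 0 := by
      rcases h with h | h
      · exact h.symm
      · exact neg_eq_zero.mp h.symm
    have hr : r = 0 := (smul_eq_zero.mp h0).resolve_right z.2
    exact ⟨z, by simp [hr]⟩
  · rintro ⟨z', hz'⟩
    obtain ⟨l, hl, -, h2⟩ := mk_eq_mk.mp hz'
    have hr : r = 0 := by simpa using h2
    left; simp [hr]

theorem blowDown_liftPoint {z : ℂ × ℂ} (hz : z ≠ 0) : blowDown (liftPoint z) = toOrbifold z := by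
  rw [liftPoint, dif_neg hz]
  exact blowDown_mk_one ⟨z, hz⟩

theorem bijOn_blowDown : Set.BijOn blowDown exceptionalᶜ {toOrbifold 0}ᶜ := by
  have hne : ∀ p : C2modZ2, p ∈ ({toOrbifold 0}ᶜ : Set C2modZ2) →
      ∃ z : {z : ℂ × ℂ // z ≠ 0}, toOrbifold z.1 = p := fun p hp => by
    induction p using Quotient.inductionOn with
    | h z => exact ⟨⟨z, fun h => hp (by rw [h]; rfl)⟩, rfl⟩
  rw [← preimage_blowDown_zero]
  refine ⟨fun x hx => hx, fun x hx y _ h => ?_, fun p hp => ?_⟩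
  · obtain ⟨z, hz⟩ := hne _ hx
    rw [eq_mk_of_blowDown_eq hz.symm, eq_mk_of_blowDown_eq (h.symm.trans hz.symm)]
  · obtain ⟨z, hz⟩ := hne _ hp
    have : blowDown (mk (z, 1)) = p := (blowDown_mk_one z).trans hz
    exact ⟨_, fun h => hp (this ▸ h), this⟩

theorem preimage_blowDown_image (S : Set (ℂ × ℂ)) :
    blowDown ⁻¹' (toOrbifold '' (S \ {0})) =
      {x | ∃ z : {z : ℂ × ℂ // z ≠ 0}, z.1 ∈ S ∧ x = mk (z, 1)} := by
  ext x
  constructor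
  · rintro ⟨z, ⟨hz, hz0⟩, h⟩
    exact ⟨⟨z, hz0⟩, hz, eq_mk_of_blowDown_eq h.symm⟩
  · rintro ⟨z, hz, rfl⟩
    exact ⟨z.1, ⟨hz, z.2⟩, (blowDown_mk_one z).symm⟩

/-- Because `i² = -1`, the half of `L_{bc}` with `t < 0` lies over `i` times the plane. -/
theorem mk_I_smul (z : {z : ℂ × ℂ // z ≠ 0}) (t : ℂ) :
    mk (⟨I • z.1, smul_ne_zero I_ne_zero z.2⟩, t) = mk (z, -t) := by
  rw [← mk_smul I_ne_zero, I_sq, neg_one_mul]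

/-- The equation of the plane determines `b + ic` as a quotient unless both imaginary parts of `z`
vanish. In that case `i z` lies in the plane with `b = c = 0`, and `t` changes sign. -/
theorem mk_mem_iUnion_extension (z : {z : ℂ × ℂ // z ≠ 0}) (t : ℝ) :
    mk (z, (t : ℂ)) ∈ ⋃ (b : ℝ) (c : ℝ), extension b c := by
  simp only [Set.mem_iUnion]
  by_cases h : ((z.1.2.im : ℂ) + I * z.1.1.im) = 0
  · have h1 : z.1.2.im = 0 := by simpa using congrArg re h
    have h2 : z.1.1.im = 0 := by simpa using congrArg im h
    refine ⟨0, 0, ⟨I • z.1, smul_ne_zero I_ne_zero z.2⟩, ?_, -t, ?_⟩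
    · simp [plane, h1, h2]
    · rw [mk_I_smul]; simp
  · set B : ℂ := ((z.1.1.re : ℂ) + I * z.1.2.re) / ((z.1.2.im : ℂ) + I * z.1.1.im) with hB
    refine ⟨B.re, B.im, z, ?_, t, rfl⟩
    rw [plane, Set.mem_ofPred_eq, mul_comm I (B.im : ℂ), Complex.re_add_im, hB,
      div_mul_cancel₀ _ h]

/-- Writing `t = r²`, one has `[z, t] = [r z, 1]` if `r ≠ 0`, so a real fibre coordinate can always
be arranged. -/
theorem iUnion_extension : ⋃ (b : ℝ) (c : ℝ), extension b c = Set.univ := by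
  rw [Set.eq_univ_iff_forall]
  intro x
  obtain ⟨z, t, rfl⟩ := exists_mk x
  obtain ⟨r, rfl⟩ := IsAlgClosed.exists_pow_nat_eq t two_pos
  rcases eq_or_ne r 0 with rfl | hr
  · simpa using mk_mem_iUnion_extension z 0
  · have h := mk_mem_iUnion_extension ⟨r • z.1, smul_ne_zero hr z.2⟩ 1
    rwa [← mk_smul hr, ofReal_one, mul_one] at h

/-! ### The parametrization of `L_{bc}` -/

/-- The point of the plane with imaginary parts `(re w, im w)`. -/
def planePoint (b c : ℝ) (w : ℂ) : ℂ × ℂ :=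
  ((I - c) * w.re + b * w.im, b * w.re + (I + c) * w.im)

theorem mem_plane_iff {b c : ℝ} {z : ℂ × ℂ} : z ∈ plane b c ↔ ∃ w, z = planePoint b c w := by
  constructor
  · intro h
    have h1 := congrArg re h
    have h2 := congrArg im h
    simp at h1 h2
    refine ⟨⟨z.1.im, z.2.im⟩, ?_⟩
    ext : 1
    all_goals apply Complex.ext
    all_goals simp [planePoint]
    all_goals linarith
  · rintro ⟨w, rfl⟩
    apply Complex.ext
    all_goals simp [planePoint]
    all_goals ring

theorem planePoint_smul (b c r : ℝ) (w : ℂ) :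
    planePoint b c (r * w) = (r : ℂ) • planePoint b c w := by
  ext <;> simp [planePoint] <;> ring

theorem planePoint_neg (b c : ℝ) (w : ℂ) : planePoint b c (-w) = -planePoint b c w := by
  simpa using planePoint_smul b c (-1) w

theorem planePoint_ne_zero (b c : ℝ) {w : ℂ} (hw : w ≠ 0) : planePoint b c w ≠ 0 := by
  intro h
  apply hw
  have h1 := congrArg (fun z => im z.1) h
  have h2 := congrArg (fun z => im z.2) h
  simp [planePoint] at h1 h2
  exact Complex.ext h1 h2

/-- The point `[z, t]` of `L_{bc}`, where `z` has the imaginary parts `(re w, im w)`. -/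
def planeMk (b c : ℝ) (w : {w : ℂ // w ≠ 0}) (t : ℝ) : KCP1 :=
  mk (⟨planePoint b c w.1, planePoint_ne_zero b c w.2⟩, (t : ℂ))

/-- The quadratic form `(re w)² + (im w)²` on the plane, as a complex quadratic form. -/
def planeForm (b c : ℝ) (z : ℂ × ℂ) : ℂ :=
  (((c + I) * z.1 - b * z.2) ^ 2 + (-b * z.1 + (I - c) * z.2) ^ 2) / (1 + b ^ 2 + c ^ 2) ^ 2

theorem one_add_sq_ne_zero (b c : ℝ) : (1 + b ^ 2 + c ^ 2 : ℂ) ≠ 0 := by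
  have : (1 + b ^ 2 + c ^ 2 : ℝ) ≠ 0 := by positivity
  exact_mod_cast this

/-- The plane is totally real: `(i - c, b)` and `(b, i + c)` form a complex basis of `ℂ²` with
determinant `-(1 + b² + c²)`. Cramer's rule then extends `re w` and `im w` to complex linear
functions of `z`. -/
theorem planeForm_planePoint (b c : ℝ) (w : ℂ) :
    planeForm b c (planePoint b c w) = w.re ^ 2 + w.im ^ 2 := by
  have h := one_add_sq_ne_zero b c
  have h1 : (c + I) * (planePoint b c w).1 - b * (planePoint b c w).2 =
      -(1 + b ^ 2 + c ^ 2) * w.re := by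
    simp only [planePoint]; linear_combination (w.re : ℂ) * I_sq
  have h2 : -b * (planePoint b c w).1 + (I - c) * (planePoint b c w).2 =
      -(1 + b ^ 2 + c ^ 2) * w.im := by
    simp only [planePoint]; linear_combination (w.im : ℂ) * I_sq
  rw [planeForm, h1, h2]
  field_simp

/-- The function `[z, t] ↦ t (A² + B²)` on `K_{ℂP¹}`, where `z ↦ (A, B)` is the complex linear map
that is `z ↦ (im z₁, im z₂)` on the plane. -/
def fibreCoord (b c : ℝ) : KCP1 → ℂ :=
  Quotient.lift (s := preSetoid) (fun x : Pre => x.2 * planeForm b c x.1.1) (by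
    rintro x y ⟨l, hl, h1, h2⟩
    simp only [h1, h2, planeForm, Prod.smul_fst, Prod.smul_snd, smul_eq_mul]
    ring)

theorem continuous_fibreCoord (b c : ℝ) : Continuous (fibreCoord b c) := by
  rw [isQuotientMap_mk.continuous_iff]
  change Continuous fun x : Pre => x.2 * planeForm b c x.1.1
  unfold planeForm
  fun_prop

/-- For `|w| = 1` this recovers `t` from the point, for use in both injectivity and properness of
the parametrization. -/
theorem fibreCoord_planeMk (b c : ℝ) (w : {w : ℂ // w ≠ 0}) (t : ℝ) :
    fibreCoord b c (planeMk b c w t) = t * (‖w.1‖ ^ 2 : ℝ) := by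
  change (t : ℂ) * planeForm b c (planePoint b c w.1) = _
  rw [planeForm_planePoint, Complex.sq_norm, Complex.normSq_apply]
  push_cast; ring

/-- A point of `L_{bc}` determines the point `w` of the unit circle up to sign. -/
theorem planeMk_eq_planeMk {b c : ℝ} {w w' : {w : ℂ // w ≠ 0}} {t t' : ℝ} (hw : ‖w.1‖ = 1)
    (hw' : ‖w'.1‖ = 1) (h : planeMk b c w t = planeMk b c w' t') : w'.1 ^ 2 = w.1 ^ 2 ∧ t = t' := by
  have ht : t = t' := by
    have := congrArg (fibreCoord b c) h
    rw [fibreCoord_planeMk, fibreCoord_planeMk, hw, hw'] at this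
    simpa using this
  refine ⟨?_, ht⟩
  obtain ⟨l, hl, h1, -⟩ := mk_eq_mk.mp h
  have hD := one_add_sq_ne_zero b c
  simp only [planePoint, Prod.smul_mk, smul_eq_mul, Prod.mk.injEq] at h1
  obtain ⟨e1, e2⟩ := h1
  -- By the same Cramer's rule, `z' = l z` forces the real coordinates of `w` to scale by the
  -- complex number `l`. The unit norms then give `l² = 1`.
  have hre : (w'.1.re : ℂ) = l * w.1.re := by
    apply mul_left_cancel₀ hD
    linear_combination (-(c + I)) * e1 + b * e2 + (w'.1.re - l * w.1.re) * I_sq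
  have him : (w'.1.im : ℂ) = l * w.1.im := by
    apply mul_left_cancel₀ hD
    linear_combination b * e1 - (I - c) * e2 + (w'.1.im - l * w.1.im) * I_sq
  have hn : ∀ {w : ℂ}, ‖w‖ = 1 → (w.re : ℂ) ^ 2 + (w.im : ℂ) ^ 2 = 1 := fun {w} h => by
    have := Complex.sq_norm w
    rw [h, Complex.normSq_apply, one_pow] at this
    exact_mod_cast (show w.re ^ 2 + w.im ^ 2 = 1 by rw [this]; ring)
  have hl2 : l ^ 2 = 1 := by
    have h1 := hn hw'
    rw [hre, him] at h1
    linear_combination h1 - l ^ 2 * hn hw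
  have : w'.1 = l * w.1 := by
    rw [← Complex.re_add_im w'.1, hre, him]
    conv_rhs => rw [← Complex.re_add_im w.1]
    ring
  rw [this, mul_pow, hl2, one_mul]

theorem exists_sq_eq (ζ : Circle) : ∃ w : {w : ℂ // w ≠ 0}, w.1 ^ 2 = ζ := by
  obtain ⟨w, hw⟩ := IsAlgClosed.exists_pow_nat_eq (ζ : ℂ) two_pos
  exact ⟨⟨w, by rintro rfl; exact ζ.coe_ne_zero (by simpa using hw.symm)⟩, hw⟩

/-- A square root of a point of the circle. -/
def root (ζ : Circle) : {w : ℂ // w ≠ 0} := (exists_sq_eq ζ).choose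

theorem root_sq (ζ : Circle) : (root ζ).1 ^ 2 = ζ := (exists_sq_eq ζ).choose_spec

theorem norm_eq_one_of_sq_eq {w : ℂ} {ζ : Circle} (h : w ^ 2 = ζ) : ‖w‖ = 1 := by
  have := congrArg norm h
  rw [norm_pow, Circle.norm_coe] at this
  exact (pow_eq_one_iff_of_nonneg (norm_nonneg _) two_ne_zero).mp this

/-- The parametrization of `L_{bc}` by `S¹ × ℝ`. -/
def param (b c : ℝ) (y : Circle × ℝ) : KCP1 := planeMk b c (root y.1) y.2

/-- The choice made by `root` is immaterial, since `[-z, s] = [z, s]`. -/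
theorem param_eq (b c : ℝ) {ζ : Circle} {w : {w : ℂ // w ≠ 0}} (h : w.1 ^ 2 = ζ) (s : ℝ) :
    param b c (ζ, s) = planeMk b c w s := by
  rcases sq_eq_sq_iff_eq_or_eq_neg.mp (h.trans (root_sq ζ).symm) with h | h
  · rw [param, show root ζ = w from Subtype.ext h.symm]
  · refine mk_eq_mk.mpr ⟨-1, by simp, ?_, by simp⟩
    change planePoint b c w.1 = _
    rw [h, planePoint_neg, neg_one_smul]

/-- Normalizing `w` to unit length is paid for by the factor `|w|²` in the fibre, which has weight
two. -/
theorem planeMk_eq_param (b c : ℝ) (w : {w : ℂ // w ≠ 0}) (t : ℝ) :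
    ∃ ζ, planeMk b c w t = param b c (ζ, ‖w.1‖ ^ 2 * t) := by
  have hn : ‖w.1‖ ≠ 0 := norm_ne_zero_iff.mpr w.2
  have hn' : (‖w.1‖ : ℂ) ≠ 0 := ofReal_ne_zero.mpr hn
  let w' : {w : ℂ // w ≠ 0} := ⟨w.1 / ‖w.1‖, div_ne_zero w.2 hn'⟩
  have hw' : ‖w'.1 ^ 2‖ = 1 := by
    simp only [w', norm_pow, norm_div, norm_real, norm_norm, div_self hn, one_pow]
  refine ⟨⟨w'.1 ^ 2, mem_sphere_zero_iff_norm.mpr hw'⟩, Eq.trans ?_ (param_eq b c (w := w') rfl _).symm⟩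
  refine (mk_eq_mk.mpr ⟨‖w.1‖, hn', ?_, by push_cast; ring⟩).symm
  change planePoint b c w.1 = (‖w.1‖ : ℂ) • planePoint b c (w.1 / ‖w.1‖)
  rw [← planePoint_smul, mul_div_cancel₀ _ hn']

theorem mem_plane_ne_zero_iff {b c : ℝ} {x : KCP1} {t : ℂ} :
    (∃ z : {z : ℂ × ℂ // z ≠ 0}, z.1 ∈ plane b c ∧ x = mk (z, t)) ↔
      ∃ w : {w : ℂ // w ≠ 0}, x = mk (⟨planePoint b c w.1, planePoint_ne_zero b c w.2⟩, t) := by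
  constructor
  · rintro ⟨z, hz, rfl⟩
    obtain ⟨w, hw⟩ := mem_plane_iff.mp hz
    have hw0 : w ≠ 0 := by
      rintro rfl
      exact z.2 (by rw [hw]; ext <;> simp [planePoint])
    exact ⟨⟨w, hw0⟩, by congr; exact Subtype.ext hw⟩
  · rintro ⟨w, rfl⟩
    exact ⟨_, mem_plane_iff.mpr ⟨w.1, rfl⟩, rfl⟩

theorem mem_extension_iff {b c : ℝ} {x : KCP1} :
    x ∈ extension b c ↔ ∃ w t, x = planeMk b c w t := by
  constructor
  · rintro ⟨z, hz, t, h⟩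
    obtain ⟨w, hw⟩ := mem_plane_ne_zero_iff.mp ⟨z, hz, h⟩
    exact ⟨w, t, hw⟩
  · rintro ⟨w, t, rfl⟩
    exact ⟨_, mem_plane_iff.mpr ⟨w.1, rfl⟩, t, rfl⟩

theorem range_param (b c : ℝ) : Set.range (param b c) = extension b c := by
  ext x
  rw [mem_extension_iff]
  constructor
  · rintro ⟨y, rfl⟩
    exact ⟨_, _, rfl⟩
  · rintro ⟨w, t, rfl⟩
    obtain ⟨ζ, h⟩ := planeMk_eq_param b c w t
    exact ⟨_, h.symm⟩

theorem injective_param (b c : ℝ) : Function.Injective (param b c) := by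
  rintro ⟨ζ, s⟩ ⟨ζ', s'⟩ h
  obtain ⟨h1, h2⟩ := planeMk_eq_planeMk (norm_eq_one_of_sq_eq (root_sq ζ))
    (norm_eq_one_of_sq_eq (root_sq ζ')) h
  simp only at h1 h2
  rw [root_sq, root_sq] at h1
  exact Prod.ext (Circle.ext h1.symm) h2

theorem fibreCoord_param (b c : ℝ) (y : Circle × ℝ) : (fibreCoord b c (param b c y)).re = y.2 := by
  rw [param, fibreCoord_planeMk, norm_eq_one_of_sq_eq (root_sq y.1)]
  simp

theorem image_param_eq_zero (b c : ℝ) :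
    param b c '' {y | y.2 = 0} = extension b c ∩ exceptional := by
  ext x
  constructor
  · rintro ⟨⟨ζ, s⟩, hs, rfl⟩
    obtain rfl : s = 0 := hs
    exact ⟨range_param b c ▸ Set.mem_range_self _, _, by rw [param, planeMk, ofReal_zero]⟩
  · rintro ⟨hx, z, hz⟩
    rw [← range_param] at hx
    obtain ⟨y, rfl⟩ := hx
    obtain ⟨l, -, -, h⟩ := mk_eq_mk.mp hz
    exact ⟨y, by simpa using h, rfl⟩

theorem planeMk_sq_mul {b c r : ℝ} (hr : r ≠ 0) (w : {w : ℂ // w ≠ 0}) (t : ℝ) :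
    planeMk b c w (r ^ 2 * t) = planeMk b c ⟨r * w.1, mul_ne_zero (ofReal_ne_zero.mpr hr) w.2⟩ t :=
  mk_eq_mk.mpr ⟨r, ofReal_ne_zero.mpr hr, planePoint_smul b c r w.1, by push_cast; rfl⟩

/-- For `s > 0` the factor `√s` can be absorbed into `w`, leaving fibre coordinate `1`. Conversely
`s = |w|²`. -/
theorem image_param_pos (b c : ℝ) : param b c '' {y | 0 < y.2} =
    blowDown ⁻¹' (toOrbifold '' (plane b c \ {0})) := by
  rw [preimage_blowDown_image]
  ext x
  rw [Set.mem_ofPred_eq, mem_plane_ne_zero_iff]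
  constructor
  · rintro ⟨⟨ζ, s⟩, hs, rfl⟩
    have hs' : √s ≠ 0 := (Real.sqrt_pos.mpr hs).ne'
    have := planeMk_sq_mul (b := b) (c := c) hs' (root ζ) 1
    rw [Real.sq_sqrt (le_of_lt hs), mul_one] at this
    exact ⟨_, by rw [param, this, planeMk, ofReal_one]⟩
  · rintro ⟨w, rfl⟩
    obtain ⟨ζ, h⟩ := planeMk_eq_param b c w 1
    have hn : 0 < ‖w.1‖ := norm_pos_iff.mpr w.2
    refine ⟨_, ?_, h.symm.trans (by rw [planeMk, ofReal_one])⟩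
    rw [Set.mem_ofPred_eq, mul_one]; positivity

theorem image_param_neg (b c : ℝ) : param b c '' {y | y.2 < 0} =
    blowDown ⁻¹' (toOrbifold '' ((fun z => I • z) '' (plane b c \ {0}))) := by
  have h1 : (fun z : ℂ × ℂ => I • z) '' (plane b c \ {0}) =
      ((fun z : ℂ × ℂ => I • z) '' plane b c) \ {0} := by
    rw [Set.image_sdiff (fun z w h => smul_right_injective _ I_ne_zero h)]; simp
  -- Trading `i z` for fibre coordinate `-1` reduces to the argument for the positive half.
  have h2 : {x | ∃ z : {z : ℂ × ℂ // z ≠ 0}, z.1 ∈ (fun z : ℂ × ℂ => I • z) '' plane b c ∧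
      x = mk (z, 1)} = {x | ∃ z : {z : ℂ × ℂ // z ≠ 0}, z.1 ∈ plane b c ∧ x = mk (z, -1)} := by
    ext x
    constructor
    · rintro ⟨⟨_, hz0⟩, ⟨z, hz, rfl⟩, rfl⟩
      exact ⟨⟨z, fun h => hz0 (by simp [h])⟩, hz, mk_I_smul ⟨z, fun h => hz0 (by simp [h])⟩ 1⟩
    · rintro ⟨z, hz, rfl⟩
      exact ⟨_, ⟨z.1, hz, rfl⟩, (mk_I_smul _ _).symm⟩
  rw [h1, preimage_blowDown_image, h2]
  ext x
  rw [Set.mem_ofPred_eq, mem_plane_ne_zero_iff]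
  constructor
  · rintro ⟨⟨ζ, s⟩, hs, rfl⟩
    have hs : s < 0 := hs
    have hs' : √(-s) ≠ 0 := (Real.sqrt_pos.mpr (neg_pos.mpr hs)).ne'
    have := planeMk_sq_mul (b := b) (c := c) hs' (root ζ) (-1)
    rw [Real.sq_sqrt (neg_nonneg.mpr hs.le), mul_neg_one, neg_neg] at this
    exact ⟨_, by rw [param, this, planeMk, ofReal_neg, ofReal_one]⟩
  · rintro ⟨w, rfl⟩
    obtain ⟨ζ, h⟩ := planeMk_eq_param b c w (-1)
    have hn : 0 < ‖w.1‖ := norm_pos_iff.mpr w.2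
    refine ⟨_, ?_, h.symm.trans (by rw [planeMk, ofReal_neg, ofReal_one])⟩
    rw [Set.mem_ofPred_eq, mul_neg_one, neg_lt_zero]; positivity

theorem mk_eq_chart0_symm {x : Pre} (h : x.1.1.1 ≠ 0) :
    mk x = chart0.symm (x.2 * x.1.1.1 ^ 2, x.1.1.2 / x.1.1.1) :=
  (chart0.left_inv ((mk_mem_dom0 x).mpr h)).symm

theorem mk_eq_chart1_symm {x : Pre} (h : x.1.1.2 ≠ 0) :
    mk x = chart1.symm (x.2 * x.1.1.2 ^ 2, x.1.1.1 / x.1.1.2) :=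
  (chart1.left_inv ((mk_mem_chart1_source x).mpr h)).symm

/-! ### Smoothness -/

/-- `z₁²` for the point `z` of the plane with imaginary parts `(re w, im w)`, `|w| = 1`, as a
function of `w²`. -/
def fstSq (b c : ℝ) (ζ : ℂ) : ℂ :=
  (I - c) ^ 2 * ((1 + ζ.re) / 2) + (I - c) * b * ζ.im + b ^ 2 * ((1 - ζ.re) / 2)

/-- `z₁ z₂` for the point `z` of the plane with imaginary parts `(re w, im w)`, `|w| = 1`, as a
function of `w²`. -/
def fstMulSnd (b c : ℝ) (ζ : ℂ) : ℂ :=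
  (I - c) * b * ((1 + ζ.re) / 2) + ((I - c) * (I + c) + b ^ 2) * (ζ.im / 2) +
    b * (I + c) * ((1 - ζ.re) / 2)

/-- `z₂²` for the point `z` of the plane with imaginary parts `(re w, im w)`, `|w| = 1`, as a
function of `w²`. -/
def sndSq (b c : ℝ) (ζ : ℂ) : ℂ :=
  b ^ 2 * ((1 + ζ.re) / 2) + b * (I + c) * ζ.im + (I + c) ^ 2 * ((1 - ζ.re) / 2)

/-- The half-angle formulas: quadratic expressions in `w` are smooth, indeed affine, in `w²`. -/
theorem re_im_sq_of_norm_eq_one {w : ℂ} (hw : ‖w‖ = 1) :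
    (1 + ((w ^ 2).re : ℂ)) / 2 = w.re ^ 2 ∧ (1 - ((w ^ 2).re : ℂ)) / 2 = w.im ^ 2 ∧
      ((w ^ 2).im : ℂ) = 2 * (w.re * w.im) := by
  have h := Complex.sq_norm w
  rw [hw, Complex.normSq_apply, one_pow] at h
  have h' : (w.re : ℂ) ^ 2 + (w.im : ℂ) ^ 2 = 1 := by
    exact_mod_cast (show w.re ^ 2 + w.im ^ 2 = 1 by rw [h]; ring)
  have e1 : ((w ^ 2).re : ℂ) = w.re ^ 2 - w.im ^ 2 := by
    rw [sq]; simp; ring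
  have e2 : ((w ^ 2).im : ℂ) = 2 * (w.re * w.im) := by
    rw [sq]; simp; ring
  refine ⟨?_, ?_, e2⟩
  · rw [e1]; linear_combination -(1 / 2 : ℂ) * h'
  · rw [e1]; linear_combination -(1 / 2 : ℂ) * h'

theorem fstSq_sq {b c : ℝ} {w : ℂ} (hw : ‖w‖ = 1) :
    fstSq b c (w ^ 2) = (planePoint b c w).1 ^ 2 := by
  obtain ⟨h1, h2, h3⟩ := re_im_sq_of_norm_eq_one hw
  rw [fstSq, h1, h2, h3, planePoint]; ring

theorem fstMulSnd_sq {b c : ℝ} {w : ℂ} (hw : ‖w‖ = 1) :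
    fstMulSnd b c (w ^ 2) = (planePoint b c w).1 * (planePoint b c w).2 := by
  obtain ⟨h1, h2, h3⟩ := re_im_sq_of_norm_eq_one hw
  rw [fstMulSnd, h1, h2, h3, planePoint]; ring

theorem sndSq_sq {b c : ℝ} {w : ℂ} (hw : ‖w‖ = 1) :
    sndSq b c (w ^ 2) = (planePoint b c w).2 ^ 2 := by
  obtain ⟨h1, h2, h3⟩ := re_im_sq_of_norm_eq_one hw
  rw [sndSq, h1, h2, h3, planePoint]; ring

theorem contDiff_fstSq (b c : ℝ) : ContDiff ℝ ∞ (fstSq b c) := by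
  have h1 : ContDiff ℝ ∞ fun ζ : ℂ => (ζ.re : ℂ) := (ofRealCLM.comp reCLM).contDiff
  have h2 : ContDiff ℝ ∞ fun ζ : ℂ => (ζ.im : ℂ) := (ofRealCLM.comp imCLM).contDiff
  unfold fstSq; fun_prop

theorem contDiff_fstMulSnd (b c : ℝ) : ContDiff ℝ ∞ (fstMulSnd b c) := by
  have h1 : ContDiff ℝ ∞ fun ζ : ℂ => (ζ.re : ℂ) := (ofRealCLM.comp reCLM).contDiff
  have h2 : ContDiff ℝ ∞ fun ζ : ℂ => (ζ.im : ℂ) := (ofRealCLM.comp imCLM).contDiff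
  unfold fstMulSnd; fun_prop

theorem contDiff_sndSq (b c : ℝ) : ContDiff ℝ ∞ (sndSq b c) := by
  have h1 : ContDiff ℝ ∞ fun ζ : ℂ => (ζ.re : ℂ) := (ofRealCLM.comp reCLM).contDiff
  have h2 : ContDiff ℝ ∞ fun ζ : ℂ => (ζ.im : ℂ) := (ofRealCLM.comp imCLM).contDiff
  unfold sndSq; fun_prop

/-- Writing `z₂ / z₁ = z₁ z₂ / z₁²` makes both coordinates even in `w`, hence functions of `ζ = w²`
that do not see the discontinuous choice of a root. -/
theorem param_eq_chart0_symm {b c : ℝ} {y : Circle × ℝ} (h : fstSq b c y.1 ≠ 0) :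
    param b c y = chart0.symm (y.2 * fstSq b c y.1, fstMulSnd b c y.1 / fstSq b c y.1) := by
  have hn := norm_eq_one_of_sq_eq (root_sq y.1)
  rw [← root_sq, fstSq_sq hn] at h ⊢
  rw [fstMulSnd_sq hn]
  have h1 : (planePoint b c (root y.1).1).1 ≠ 0 := fun h0 => h (by rw [h0]; simp)
  rw [param, planeMk, mk_eq_chart0_symm h1]
  dsimp only
  congr 2
  field_simp

theorem param_eq_chart1_symm {b c : ℝ} {y : Circle × ℝ} (h : sndSq b c y.1 ≠ 0) :
    param b c y = chart1.symm (y.2 * sndSq b c y.1, fstMulSnd b c y.1 / sndSq b c y.1) := by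
  have hn := norm_eq_one_of_sq_eq (root_sq y.1)
  rw [← root_sq, sndSq_sq hn] at h ⊢
  rw [fstMulSnd_sq hn]
  have h1 : (planePoint b c (root y.1).1).2 ≠ 0 := fun h0 => h (by rw [h0]; simp)
  rw [param, planeMk, mk_eq_chart1_symm h1]
  dsimp only
  congr 2
  field_simp

/-- The map `(ζ, s) ↦ (s N(ζ), M(ζ) / N(ζ))` on `S¹ × ℝ` is smooth where `N ≠ 0`. -/
theorem contMDiffAt_circle_prod {N M : ℂ → ℂ} (hN : ContDiff ℝ ∞ N) (hM : ContDiff ℝ ∞ M)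
    {y : Circle × ℝ} (h : N y.1 ≠ 0) : ContMDiffAt ((𝓡 1).prod 𝓘(ℝ, ℝ)) 𝓘(ℝ, ℂ × ℂ) ∞
      (fun y : Circle × ℝ => ((y.2 * N y.1, M y.1 / N y.1) : ℂ × ℂ)) y := by
  have := finrank_real_complex_fact'
  have hcoe : ContMDiff (𝓡 1) 𝓘(ℝ, ℂ) ∞ fun ζ : Circle => (ζ : ℂ) :=
    contMDiff_coe_sphere (E := ℂ) (n := 1)
  have h1 : ContMDiff ((𝓡 1).prod 𝓘(ℝ, ℝ)) 𝓘(ℝ, ℂ) ∞ fun y : Circle × ℝ => (y.1 : ℂ) :=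
    hcoe.comp contMDiff_fst
  have h2 : ContMDiff ((𝓡 1).prod 𝓘(ℝ, ℝ)) 𝓘(ℝ, ℝ) ∞ fun y : Circle × ℝ => y.2 := contMDiff_snd
  have h12 := h1.prodMk_space h2
  have hG : ContDiffAt ℝ ∞ (fun p : ℂ × ℝ => (((p.2 : ℂ) * N p.1, M p.1 / N p.1) : ℂ × ℂ))
      ((y.1 : ℂ), y.2) := by
    have hN' : ContDiffAt ℝ ∞ (fun p : ℂ × ℝ => N p.1) ((y.1 : ℂ), y.2) :=
      (hN.comp contDiff_fst).contDiffAt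
    have hM' : ContDiffAt ℝ ∞ (fun p : ℂ × ℝ => M p.1) ((y.1 : ℂ), y.2) :=
      (hM.comp contDiff_fst).contDiffAt
    have h' := hM'.mul (hN'.inv h)
    refine (((ofRealCLM.contDiff.comp contDiff_snd).contDiffAt).mul hN').prodMk ?_
    simp only [div_eq_mul_inv]
    exact h'
  exact ContMDiffAt.comp (g := fun p : ℂ × ℝ => (((p.2 : ℂ) * N p.1, M p.1 / N p.1) : ℂ × ℂ)) y
    hG.contMDiffAt h12.contMDiffAt

theorem contMDiffAt_chart_symm {e : OpenPartialHomeomorph KCP1 (ℂ × ℂ)}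
    (he : e ∈ atlas (ℂ × ℂ) KCP1) {y : ℂ × ℂ} (hy : y ∈ e.target) :
    ContMDiffAt 𝓘(ℝ, ℂ × ℂ) 𝓘(ℝ, ℂ × ℂ) ∞ e.symm y :=
  contMDiffAt_symm_of_mem_maximalAtlas
    (IsManifold.subset_maximalAtlas (I := 𝓘(ℝ, ℂ × ℂ)) (n := ∞) he) hy

theorem contMDiff_param (b c : ℝ) :
    ContMDiff ((𝓡 1).prod 𝓘(ℝ, ℝ)) 𝓘(ℝ, ℂ × ℂ) ∞ (param b c) := by
  intro y
  have hcont : Continuous fun y : Circle × ℝ => (y.1 : ℂ) := by fun_prop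
  by_cases h : fstSq b c y.1 = 0
  · have h' : sndSq b c y.1 ≠ 0 := by
      intro h'
      have hn := norm_eq_one_of_sq_eq (root_sq y.1)
      rw [← root_sq, fstSq_sq hn] at h
      rw [← root_sq, sndSq_sq hn] at h'
      exact planePoint_ne_zero b c (root y.1).2
        (Prod.ext (pow_eq_zero_iff two_ne_zero |>.mp h) (pow_eq_zero_iff two_ne_zero |>.mp h'))
    have hG := contMDiffAt_circle_prod (contDiff_sndSq b c) (contDiff_fstMulSnd b c) h'
    refine (ContMDiffAt.comp y (contMDiffAt_chart_symm chart1_mem_atlas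
      (by rw [chart1_target]; trivial)) hG).congr_of_eventuallyEq ?_
    exact ((((contDiff_sndSq b c).continuous.comp hcont).continuousAt).eventually_ne h').mono
      fun z hz => param_eq_chart1_symm hz
  · have hG := contMDiffAt_circle_prod (contDiff_fstSq b c) (contDiff_fstMulSnd b c) h
    refine (ContMDiffAt.comp y (contMDiffAt_chart_symm chart0_mem_atlas
      (Set.mem_univ _)) hG).congr_of_eventuallyEq ?_
    exact ((((contDiff_fstSq b c).continuous.comp hcont).continuousAt).eventually_ne h).mono
      fun z hz => param_eq_chart0_symm hz

/-- Composed with `Re fibreCoord` the parametrization becomes the projection to `s`, which is proper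
because the circle is compact. Hence the parametrization is proper, and so closed. -/
theorem isClosedEmbedding_param (b c : ℝ) : IsClosedEmbedding (param b c) := by
  have hc := (contMDiff_param b c).continuous
  refine .of_continuous_injective_isClosedMap hc (injective_param b c) ?_
  refine (isProperMap_of_comp_of_t2 hc
    (Complex.continuous_re.comp (continuous_fibreCoord b c)) ?_).isClosedMap
  have : (Complex.re ∘ fibreCoord b c) ∘ param b c = Prod.snd := by
    funext y; exact fibreCoord_param b c y
  rw [this]
  exact isProperMap_snd_of_compactSpace

/-! ### The differential -/

/-- The differential of `(φ, s) ↦ (s z₁(φ)², z₂(φ) / z₁(φ))`, where `z` has derivative `z'`. -/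
def ruledDeriv (z z' : ℂ × ℂ) (s : ℝ) (v : ℝ × ℝ) : ℂ × ℂ :=
  (v.2 * z.1 ^ 2 + v.1 * (2 * s * z.1 * z'.1), v.1 * ((z.1 * z'.2 - z.2 * z'.1) / z.1 ^ 2))

theorem exists_hasFDerivAt_ruled {z₁ z₂ : ℝ → ℂ} {z' : ℂ × ℂ} {y : ℝ × ℝ}
    (h₁ : HasDerivAt z₁ z'.1 y.1) (h₂ : HasDerivAt z₂ z'.2 y.1) (h : z₁ y.1 ≠ 0) :
    ∃ T : ℝ × ℝ →L[ℝ] ℂ × ℂ,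
      HasFDerivAt (fun y : ℝ × ℝ => (((y.2 : ℂ) * z₁ y.1 ^ 2, z₂ y.1 / z₁ y.1) : ℂ × ℂ)) T y ∧
        ∀ v, T v = ruledDeriv (z₁ y.1, z₂ y.1) z' y.2 v := by
  have e1 : HasFDerivAt (𝕜 := ℝ) (fun y : ℝ × ℝ => y.1) _ y := hasFDerivAt_fst
  have e2 : HasFDerivAt (𝕜 := ℝ) (fun y : ℝ × ℝ => (y.2 : ℂ)) _ y :=
    ofRealCLM.hasFDerivAt.comp y hasFDerivAt_snd
  have k1 := (h₁.pow 2).hasFDerivAt.comp y e1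
  have k2 := (h₂.div h₁ h).hasFDerivAt.comp y e1
  refine ⟨_, (e2.mul k1).prodMk k2, fun v => ?_⟩
  ext1
  · simp [ruledDeriv]; ring
  · simp [ruledDeriv]; exact Or.inl (by ring)

theorem theta_ruledDeriv {z z' : ℂ × ℂ} (hz : z.1 ≠ 0) (s : ℝ) (v : ℝ × ℝ) :
    theta (s * z.1 ^ 2, z.2 / z.1) (ruledDeriv z z' s v) =
      z.1 / conj z.1 * (v.2 * (U z / 2 : ℝ) + v.1 * s * (conj z.1 * z'.1 + conj z.2 * z'.2)) := by
  have hz' : conj z.1 ≠ 0 := by simpa using hz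
  simp only [theta_apply, ruledDeriv, ofReal_div, ofReal_height, ofReal_U, map_div₀]
  push_cast
  field_simp
  ring

theorem im_mul_conj_ofReal_mul (κ : ℂ) (x y : ℝ) : (x * κ * conj (y * κ)).im = 0 := by
  have : x * κ * conj (y * κ) = ((x * y * ‖κ‖ ^ 2 : ℝ) : ℂ) := by
    rw [map_mul, conj_ofReal]; push_cast; rw [← Complex.mul_conj']; ring
  rw [this, ofReal_im]

/-- The Eguchi–Hanson form vanishes on a surface ruled by the real lines `ℝ z ⊗ z`, if the
Hermitian product of `z` and its derivative is real. -/
theorem chartEH_ruledDeriv (a : ℝ) {z z' : ℂ × ℂ} (hz : z.1 ≠ 0) (s : ℝ)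
    (h : (conj z.1 * z'.1 + conj z.2 * z'.2).im = 0) (v w : ℝ × ℝ) :
    chartEH a (s * z.1 ^ 2, z.2 / z.1) ![ruledDeriv z z' s v, ruledDeriv z z' s w] = 0 := by
  obtain ⟨ρ, hρ⟩ : ∃ ρ : ℝ, conj z.1 * z'.1 + conj z.2 * z'.2 = ρ :=
    ⟨_, Complex.ext (ofReal_re _).symm (by rw [h, ofReal_im])⟩
  -- The values of `θ` are real multiples of the one number `z₁ / z̄₁`, so the second term vanishes.
  -- The first vanishes because `q` moves only with `φ`, so that the `q`-components are real
  -- multiples of one number too.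
  have ht : ∀ v, theta (s * z.1 ^ 2, z.2 / z.1) (ruledDeriv z z' s v) =
      ((v.2 * (U z / 2) + v.1 * s * ρ : ℝ) : ℂ) * (z.1 / conj z.1) := fun v => by
    rw [theta_ruledDeriv hz, hρ]; push_cast; ring
  rw [chartEH_apply, ht, ht, im_mul_conj_ofReal_mul]
  simp only [ruledDeriv]
  rw [im_mul_conj_ofReal_mul]
  simp

/-- The terms containing `s` drop out by antisymmetry, because the `q`-component has only a
`φ`-part. So the value does not degenerate at the exceptional curve. -/
theorem wedge_ruledDeriv {z z' : ℂ × ℂ} (hz : z.1 ≠ 0) (s : ℝ) (v w : ℝ × ℝ) :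
    wedge d1 d2 ![ruledDeriv z z' s v, ruledDeriv z z' s w] =
      ((v.2 * w.1 - w.2 * v.1 : ℝ) : ℂ) * (z.1 * z'.2 - z.2 * z'.1) := by
  simp [ruledDeriv]
  field_simp
  ring

theorem im_smul_wedge_ruledDeriv {z z' : ℂ × ℂ} (hz : z.1 ≠ 0) (s : ℝ)
    (h : (z.1 * z'.2 - z.2 * z'.1).im = 0) (ε : ℝ) (v w : ℝ × ℝ) :
    (((ε : ℂ) • wedge d1 d2) ![ruledDeriv z z' s v, ruledDeriv z z' s w]).im = 0 := by
  rw [ContinuousAlternatingMap.smul_apply, wedge_ruledDeriv hz, smul_eq_mul, im_ofReal_mul,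
    im_ofReal_mul, h]
  simp

/-- The differential is triangular, with diagonal entries that do not involve `s`. -/
theorem eq_zero_of_ruledDeriv_eq_zero {z z' : ℂ × ℂ} (hz : z.1 ≠ 0) {s : ℝ}
    (h : z.1 * z'.2 - z.2 * z'.1 ≠ 0) {v : ℝ × ℝ} (hv : ruledDeriv z z' s v = 0) : v = 0 := by
  have h1 : v.1 = 0 := by
    have := congrArg Prod.snd hv
    simpa [ruledDeriv, hz, h] using this
  have h2 : v.2 = 0 := by
    have := congrArg Prod.fst hv
    simpa [ruledDeriv, hz, h1] using this
  exact Prod.ext h1 h2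

/-- The parametrization of `L_{bc}`, lifted to `ℝ × ℝ` by `φ ↦ e^{2 i φ}`. -/
def paramLift (b c : ℝ) (y : ℝ × ℝ) : KCP1 :=
  planeMk b c ⟨Circle.exp y.1, Circle.coe_ne_zero _⟩ y.2

/-- The map `(φ, s) ↦ (e^{2 i φ}, s)`. -/
def cover (y : ℝ × ℝ) : Circle × ℝ := (Circle.exp (2 * y.1), y.2)

theorem param_comp_cover (b c : ℝ) : param b c ∘ cover = paramLift b c := by
  funext y
  refine param_eq b c (w := ⟨Circle.exp y.1, Circle.coe_ne_zero _⟩) ?_ y.2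
  rw [two_mul, Circle.exp_add, Circle.coe_mul, sq]

theorem surjective_cover : Function.Surjective cover := by
  rintro ⟨ζ, s⟩
  refine ⟨(Complex.arg ζ / 2, s), ?_⟩
  rw [cover, mul_div_cancel₀ _ two_ne_zero, Circle.exp_arg]

theorem contMDiff_cover : ContMDiff 𝓘(ℝ, ℝ × ℝ) ((𝓡 1).prod 𝓘(ℝ, ℝ)) ∞ cover := by
  have h : ContMDiff 𝓘(ℝ, ℝ × ℝ) 𝓘(ℝ, ℝ) ∞ fun y : ℝ × ℝ => 2 * y.1 :=
    (contDiff_const.mul contDiff_fst).contMDiff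
  exact (contMDiff_circleExp.comp h).prodMk contDiff_snd.contMDiff

/-- The first coordinate of `planePoint b c (e^{i φ})`. -/
def planeCurve₁ (b c : ℝ) (φ : ℝ) : ℂ := (planePoint b c (Circle.exp φ)).1

/-- The second coordinate of `planePoint b c (e^{i φ})`. -/
def planeCurve₂ (b c : ℝ) (φ : ℝ) : ℂ := (planePoint b c (Circle.exp φ)).2

theorem hasDerivAt_planeCurve (b c φ : ℝ) :
    HasDerivAt (planeCurve₁ b c) (planePoint b c (I * Circle.exp φ)).1 φ ∧
      HasDerivAt (planeCurve₂ b c) (planePoint b c (I * Circle.exp φ)).2 φ := by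
  have hc := (Real.hasDerivAt_cos φ).ofReal_comp
  have hs := (Real.hasDerivAt_sin φ).ofReal_comp
  constructor
  · refine ((((hc.const_mul (I - c)).add (hs.const_mul (b : ℂ)))).congr_deriv
      ?_).congr_of_eventuallyEq (Filter.Eventually.of_forall fun t => ?_)
    · simp [planePoint]
    · simp [planeCurve₁, planePoint]
  · refine ((((hc.const_mul (b : ℂ)).add (hs.const_mul (I + c)))).congr_deriv
      ?_).congr_of_eventuallyEq (Filter.Eventually.of_forall fun t => ?_)
    · simp [planePoint]
    · simp [planeCurve₂, planePoint]

/-- `planePoint` is real linear, so this is the determinant `-(1 + b² + c²)` of its basis times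
`|w|²`. Being real it gives `Im Ω = 0`, and being nonzero it gives the immersion. -/
theorem planePoint_det (b c : ℝ) {w : ℂ} (hw : ‖w‖ = 1) :
    (planePoint b c w).1 * (planePoint b c (I * w)).2 -
      (planePoint b c w).2 * (planePoint b c (I * w)).1 = ((-(1 + b ^ 2 + c ^ 2) : ℝ) : ℂ) := by
  have h := Complex.sq_norm w
  rw [hw, Complex.normSq_apply, one_pow] at h
  have h' : (w.re : ℂ) ^ 2 + (w.im : ℂ) ^ 2 = 1 := by
    exact_mod_cast (show w.re ^ 2 + w.im ^ 2 = 1 by rw [h]; ring)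
  simp [planePoint]
  linear_combination (-(1 + b ^ 2 + c ^ 2 : ℂ)) * h' +
    ((w.re : ℂ) ^ 2 + (w.im : ℂ) ^ 2) * I_sq

/-- The plane is Lagrangian. -/
theorem planePoint_hermitian_real (b c : ℝ) (w w' : ℂ) :
    (conj (planePoint b c w).1 * (planePoint b c w').1 +
      conj (planePoint b c w).2 * (planePoint b c w').2).im = 0 := by
  simp [planePoint]
  ring

theorem paramLift_eq_chart0_symm {b c : ℝ} {y : ℝ × ℝ} (h : planeCurve₁ b c y.1 ≠ 0) :
    paramLift b c y =
      chart0.symm (y.2 * planeCurve₁ b c y.1 ^ 2, planeCurve₂ b c y.1 / planeCurve₁ b c y.1) :=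
  mk_eq_chart0_symm h

theorem paramLift_eq_chart1_symm {b c : ℝ} {y : ℝ × ℝ} (h : planeCurve₂ b c y.1 ≠ 0) :
    paramLift b c y =
      chart1.symm (y.2 * planeCurve₂ b c y.1 ^ 2, planeCurve₁ b c y.1 / planeCurve₂ b c y.1) :=
  mk_eq_chart1_symm h

theorem eq_zero_of_mfderiv_eq_zero {e : OpenPartialHomeomorph KCP1 (ℂ × ℂ)}
    (he : e ∈ atlas (ℂ × ℂ) KCP1) {f : ℝ × ℝ → KCP1} {y : ℝ × ℝ} {G : ℝ × ℝ → ℂ × ℂ}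
    {D : ℝ × ℝ →L[ℝ] ℂ × ℂ} (hG : HasFDerivAt G D y) (hy : ∀ z, G z ∈ e.target)
    (hf : f =ᶠ[𝓝 y] e.symm ∘ G) {v : ℝ × ℝ} (hv : mfderiv 𝓘(ℝ, ℝ × ℝ) 𝓘(ℝ, ℂ × ℂ) f y v = 0) :
    D v = 0 := by
  have := mfderiv_chart_comp he hG.hasMFDerivAt hy hf v
  rw [hv, map_zero] at this
  exact this.symm

/-- Where `z₁ = 0` the second chart is used with the coordinates exchanged. This only changes the
sign of the determinant, so it stays real and nonzero. -/
theorem paramLift_properties (a b c : ℝ) (y : ℝ × ℝ) :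
    (∀ v : ℝ × ℝ, mfderiv 𝓘(ℝ, ℝ × ℝ) 𝓘(ℝ, ℂ × ℂ) (paramLift b c) y v = 0 → v = 0) ∧
      ∀ v w : ℝ × ℝ, pullback 𝓘(ℝ, ℝ × ℝ) (paramLift b c) (omega a) y ![v, w] = 0 ∧
        (pullback 𝓘(ℝ, ℝ × ℝ) (paramLift b c) Omega y ![v, w]).im = 0 := by
  obtain ⟨h₁, h₂⟩ := hasDerivAt_planeCurve b c y.1
  have hdet := planePoint_det b c (Circle.norm_coe (Circle.exp y.1))
  have hherm := planePoint_hermitian_real b c (Circle.exp y.1) (I * Circle.exp y.1)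
  have hne : (-(1 + b ^ 2 + c ^ 2) : ℝ) ≠ 0 := by
    have : 0 < 1 + b ^ 2 + c ^ 2 := by positivity
    linarith
  by_cases h : planeCurve₁ b c y.1 = 0
  · have h' : planeCurve₂ b c y.1 ≠ 0 := fun h' =>
      planePoint_ne_zero b c (Circle.coe_ne_zero (Circle.exp y.1)) (Prod.ext h h')
    obtain ⟨T, hT, hTv⟩ := exists_hasFDerivAt_ruled
      (z' := (planePoint b c (I * Circle.exp y.1)).swap) h₂ h₁ h'
    have hf : paramLift b c =ᶠ[𝓝 y] chart1.symm ∘ fun y : ℝ × ℝ =>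
        (((y.2 : ℂ) * planeCurve₂ b c y.1 ^ 2, planeCurve₁ b c y.1 / planeCurve₂ b c y.1) :
          ℂ × ℂ) :=
      ((h₂.continuousAt.comp continuous_fst.continuousAt).eventually_ne h').mono
        fun z hz => paramLift_eq_chart1_symm hz
    have hdet' : planeCurve₂ b c y.1 * (planePoint b c (I * Circle.exp y.1)).1 -
        planeCurve₁ b c y.1 * (planePoint b c (I * Circle.exp y.1)).2 =
          ((1 + b ^ 2 + c ^ 2 : ℝ) : ℂ) := by
      rw [planeCurve₁, planeCurve₂, ← neg_neg (1 + b ^ 2 + c ^ 2 : ℝ), ofReal_neg, ← hdet]; ring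
    refine ⟨fun v hv => ?_, fun v w => ⟨?_, ?_⟩⟩
    · have := eq_zero_of_mfderiv_eq_zero chart1_mem_atlas hT
        (fun z => by rw [chart1_target]; trivial) hf hv
      rw [hTv] at this
      refine eq_zero_of_ruledDeriv_eq_zero h' ?_ this
      refine hdet'.trans_ne (ofReal_ne_zero.mpr ?_)
      exact neg_ne_zero.mp hne
    · refine (pullback_ofCharts_of_hasFDerivAt_chart1 (compatible_chartEH a) hT hTv hf v w).trans ?_
      refine chartEH_ruledDeriv a (z := (planeCurve₂ b c y.1, planeCurve₁ b c y.1)) h' _ ?_ v w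
      rw [add_comm] at hherm
      exact hherm
    · refine (congrArg im (pullback_ofCharts_of_hasFDerivAt_chart1 compatible_wedge
        hT hTv hf v w)).trans ?_
      have := im_smul_wedge_ruledDeriv (z := (planeCurve₂ b c y.1, planeCurve₁ b c y.1))
        (z' := (planePoint b c (I * Circle.exp y.1)).swap) h' y.2
        ((congrArg im hdet').trans (ofReal_im _)) (-1 / 2) v w
      push_cast at this
      exact this
  · obtain ⟨T, hT, hTv⟩ := exists_hasFDerivAt_ruled h₁ h₂ h
    have hf : paramLift b c =ᶠ[𝓝 y] chart0.symm ∘ fun y : ℝ × ℝ =>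
        (((y.2 : ℂ) * planeCurve₁ b c y.1 ^ 2, planeCurve₂ b c y.1 / planeCurve₁ b c y.1) :
          ℂ × ℂ) :=
      ((h₁.continuousAt.comp continuous_fst.continuousAt).eventually_ne h).mono
        fun z hz => paramLift_eq_chart0_symm hz
    refine ⟨fun v hv => ?_, fun v w => ⟨?_, ?_⟩⟩
    · have := eq_zero_of_mfderiv_eq_zero chart0_mem_atlas hT (fun z => Set.mem_univ _) hf hv
      rw [hTv] at this
      exact eq_zero_of_ruledDeriv_eq_zero h (hdet.trans_ne (ofReal_ne_zero.mpr hne)) this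
    · refine (pullback_ofCharts_of_hasFDerivAt_chart0 hT hTv hf v w).trans ?_
      exact chartEH_ruledDeriv a (z := (planeCurve₁ b c y.1, planeCurve₂ b c y.1)) h _ hherm v w
    · refine (congrArg im (pullback_ofCharts_of_hasFDerivAt_chart0 hT hTv hf v w)).trans ?_
      have := im_smul_wedge_ruledDeriv (z := (planeCurve₁ b c y.1, planeCurve₂ b c y.1))
        (z' := planePoint b c (I * Circle.exp y.1)) h y.2
        ((congrArg im hdet).trans (ofReal_im _)) (1 / 2) v w
      push_cast at this
      exact this

/-! ### Descent from `ℝ × ℝ` to `S¹ × ℝ`. -/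

theorem mfderiv_param_comp_cover (b c : ℝ) (y : ℝ × ℝ) :
    mfderiv 𝓘(ℝ, ℝ × ℝ) 𝓘(ℝ, ℂ × ℂ) (param b c ∘ cover) y =
      (mfderiv ((𝓡 1).prod 𝓘(ℝ, ℝ)) 𝓘(ℝ, ℂ × ℂ) (param b c) (cover y)).comp
        (mfderiv 𝓘(ℝ, ℝ × ℝ) ((𝓡 1).prod 𝓘(ℝ, ℝ)) cover y) :=
  mfderiv_comp y ((contMDiff_param b c).mdifferentiable (by simp) _)
    (contMDiff_cover.mdifferentiable (by simp) _)

/-- By the chain rule the differential of `cover` is injective, as the composite with a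
parametrization is an immersion. Both tangent spaces have dimension two. -/
theorem surjective_mfderiv_cover (y : ℝ × ℝ) :
    Function.Surjective (mfderiv 𝓘(ℝ, ℝ × ℝ) ((𝓡 1).prod 𝓘(ℝ, ℝ)) cover y) := by
  have hinj : Function.Injective (mfderiv 𝓘(ℝ, ℝ × ℝ) ((𝓡 1).prod 𝓘(ℝ, ℝ)) cover y) := by
    rw [injective_iff_map_eq_zero]
    intro v hv
    -- Any of the surfaces serves this purpose; here `b = c = 0`.
    apply (paramLift_properties 0 0 0 y).1
    rw [← param_comp_cover, mfderiv_param_comp_cover, ContinuousLinearMap.comp_apply, hv, map_zero]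
  have hdim : Module.finrank ℝ (ℝ × ℝ) = Module.finrank ℝ (EuclideanSpace ℝ (Fin 1) × ℝ) := by
    simp
  exact (LinearMap.injective_iff_surjective_of_finrank_eq_finrank (V := ℝ × ℝ)
    (V₂ := EuclideanSpace ℝ (Fin 1) × ℝ) hdim
    (f := (mfderiv 𝓘(ℝ, ℝ × ℝ) ((𝓡 1).prod 𝓘(ℝ, ℝ)) cover y).toLinearMap)).mp hinj

theorem isClosedSmoothEmbedding_param (b c : ℝ) :
    IsClosedSmoothEmbedding ((𝓡 1).prod 𝓘(ℝ, ℝ)) (param b c) where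
  smooth := contMDiff_param b c
  immersion y := by
    obtain ⟨y, rfl⟩ := surjective_cover y
    rw [injective_iff_map_eq_zero]
    intro v hv
    -- Every tangent vector of `S¹ × ℝ` lifts to `ℝ × ℝ`, where the differential is known.
    obtain ⟨v, rfl⟩ := surjective_mfderiv_cover y v
    have : v = 0 := by
      apply (paramLift_properties 0 b c y).1
      rw [← param_comp_cover, mfderiv_param_comp_cover, ContinuousLinearMap.comp_apply, hv]
    rw [this, map_zero]
  closedEmbedding := isClosedEmbedding_param b c

theorem isSpecialLagrangian_param (a b c : ℝ) :
    IsSpecialLagrangian ((𝓡 1).prod 𝓘(ℝ, ℝ)) (param b c) (omega a) Omega := by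
  refine ⟨by simp, fun y v w => ?_⟩
  obtain ⟨y, rfl⟩ := surjective_cover y
  obtain ⟨v, rfl⟩ := surjective_mfderiv_cover y v
  obtain ⟨w, rfl⟩ := surjective_mfderiv_cover y w
  obtain ⟨h1, h2⟩ := (paramLift_properties a b c y).2 v w
  rw [← param_comp_cover] at h1 h2
  have key : ∀ {F : Type} [AddCommGroup F] [Module ℝ F] [TopologicalSpace F] (η : TwoForm F),
      pullback 𝓘(ℝ, ℝ × ℝ) (param b c ∘ cover) η y ![v, w] =
        pullback ((𝓡 1).prod 𝓘(ℝ, ℝ)) (param b c) η (cover y)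
          ![mfderiv 𝓘(ℝ, ℝ × ℝ) ((𝓡 1).prod 𝓘(ℝ, ℝ)) cover y v,
            mfderiv 𝓘(ℝ, ℝ × ℝ) ((𝓡 1).prod 𝓘(ℝ, ℝ)) cover y w] := by
    intro F _ _ _ η
    rw [pullback_apply, pullback_apply, mfderiv_param_comp_cover]
    rfl
  rw [key] at h1 h2
  exact ⟨h1, h2⟩

end EguchiHanson

end

open EguchiHanson in
theorem theorem4 (a : ℝ) (ha : 0 < a) :
    -- the blow-down map contracts exactly the exceptional curve and is invertible elsewhere
    (blowDown ⁻¹' {toOrbifold 0} = exceptional ∧ Set.BijOn blowDown exceptionalᶜ {toOrbifold 0}ᶜ ∧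
      ∀ z : ℂ × ℂ, z ≠ 0 → blowDown (liftPoint z) = toOrbifold z) ∧
    -- the Eguchi–Hanson Ricci-flat Kähler metric and the holomorphic form
    (IsKaehlerForm (omega a) ∧ IsRicciFlat (omega a) ∧
      IsHolomorphicVolumeForm Omega ∧ IsNormalized (omega a) Omega ∧
      ∀ z : ℂ × ℂ, z ≠ 0 → ∀ v w : ℂ × ℂ,
        ((pullback 𝓘(ℝ, ℂ × ℂ) liftPoint (omega a) z ![v, w] : ℝ) : ℂ) = flatEH a z ![v, w] ∧
        pullback 𝓘(ℝ, ℂ × ℂ) liftPoint Omega z ![v, w] = wedge d1 d2 ![v, w]) ∧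
    -- the submanifolds
    (∀ b c : ℝ, ∃ f : Circle × ℝ → KCP1,
      IsClosedSmoothEmbedding ((𝓡 1).prod 𝓘(ℝ, ℝ)) f ∧
      Set.range f = extension b c ∧
      f '' {y | 0 < y.2} = blowDown ⁻¹' (toOrbifold '' (plane b c \ {0})) ∧
      f '' {y | y.2 < 0} =
        blowDown ⁻¹' (toOrbifold '' ((fun z => Complex.I • z) '' (plane b c \ {0}))) ∧
      f '' {y | y.2 = 0} = extension b c ∩ exceptional ∧
      IsSpecialLagrangian ((𝓡 1).prod 𝓘(ℝ, ℝ)) f (omega a) Omega) ∧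
    -- they cover
    (⋃ (b : ℝ) (c : ℝ), extension b c) = Set.univ :=
  ⟨⟨preimage_blowDown_zero, bijOn_blowDown, fun _ hz => blowDown_liftPoint hz⟩,
    ⟨isKaehlerForm_omega ha, isRicciFlat_omega ha, isHolomorphicVolumeForm_Omega,
      isNormalized_omega_Omega ha, fun _ hz v w => pullback_liftPoint ha hz v w⟩,
    fun b c => ⟨param b c, isClosedSmoothEmbedding_param b c, range_param b c,
      image_param_pos b c, image_param_neg b c, image_param_eq_zero b c,
      isSpecialLagrangian_param a b c⟩,
    iUnion_extension⟩
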